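/- All vector spaces are over $\mathbb{C}$. Let $\mathcal{A}$ be a Hopf algebra with coproduct $\Delta$, and let $(\mathcal{E},d)$ be a bicovariant first order differential calculus over $\mathcal{A}$: $\mathcal{E}$ is an $\mathcal{A}$-bimodule, $d:\mathcal{A}\to\mathcal{E}$ is linear with $d(ab)=(da)b+a\,db$, every element of $\mathcal{E}$ is a finite sum $\sum_k a_k\,db_k$, and $\sum_k a_k\,db_k=0$ implies both $\sum_k\Delta(a_k)(\mathrm{id}\otimes d)\Delta(b_k)=0$ and $\sum_k\Delta(a_k)(d\otimes\mathrm{id})\Delta(b_k)=0$. Let $\Delta_{\mathcal{E}}:\mathcal{E}\to\mathcal{A}\otimes\mathcal{E}$, $a\,db\mapsto\Delta(a)(\mathrm{id}\otimes d)\Delta(b)$, and ${}_{\mathcal{E}}\Delta:\mathcal{E}\to\mathcal{E}\otimes\mathcal{A}$, $a\,db\mapsto\Delta(a)(d\otimes\mathrm{id})\Delta(b)$, be the left and right coactions, and give $\mathcal{E}\otimes_{\mathcal{A}}\mathcal{E}$ the induced left and right coactions. Write ${}_0M$ and $M_0$ for the left-invariant and the right-invariant elements of $M$ (those whose left, resp.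 right, coaction is $1\otimes m$, resp. $m\otimes 1$), and suppose that ${}_0\mathcal{E}$ is finite-dimensional. There is a unique $\mathcal{A}$-bimodule endomorphism $\sigma$ of $\mathcal{E}\otimes_{\mathcal{A}}\mathcal{E}$ with $\sigma(\omega\otimes_{\mathcal{A}}\eta)=\eta\otimes_{\mathcal{A}}\omega$ for all $\omega\in{}_0\mathcal{E}$ and $\eta\in\mathcal{E}_0$; it maps ${}_0(\mathcal{E}\otimes_{\mathcal{A}}\mathcal{E})$ (which is identified with ${}_0\mathcal{E}\otimes_{\mathbb{C}}{}_0\mathcal{E}$) into itself. Let ${}_0\sigma$ be its restriction to that space, $\Lambda$ the set of eigenvalues of ${}_0\sigma$, $V_\lambda$ the eigenspace for $\lambda\in\Lambda$, ${}_0\mathcal{F}=\sum_{\lambda\in\Lambda\setminus\{1\}}V_\lambda$, $\Omega^2(\mathcal{A})=(\mathcal{E}\otimes_{\mathcal{A}}\mathcal{E})/\mathrm{Ker}(\sigma-1)$, and $\wedge:\mathcal{E}\otimes_{\mathcal{A}}\mathcal{E}\to\Omega^2(\mathcal{A})$ the quotient map. Suppose that ${}_0\sigma$ is diagonalisable, and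 let $\mathcal{F}=\mathcal{A}\cdot{}_0\mathcal{F}$ be the linear span of the products $aw$ with $a\in\mathcal{A}$, $w\in{}_0\mathcal{F}$. Then: (1) $\mathcal{F}$ is an $\mathcal{A}$-sub-bimodule of $\mathcal{E}\otimes_{\mathcal{A}}\mathcal{E}$; if the antipode of $\mathcal{A}$ is bijective, then also $\mathcal{F}={}_0\mathcal{F}\cdot\mathcal{A}$, the linear span of the products $wa$. (2) $\mathcal{E}\otimes_{\mathcal{A}}\mathcal{E}=\mathrm{Ker}(\wedge)\oplus\mathcal{F}$. (3) The restriction $\wedge|_{\mathcal{F}}:\mathcal{F}\to\Omega^2(\mathcal{A})$ is an isomorphism of $\mathcal{A}$-bimodules, in particular of right $\mathcal{A}$-modules. (4) $\Lambda$ is finite, and $$P_{\mathrm{sym}}=\prod_{\lambda\in\Lambda\setminus\{1\}}\frac{\sigma-\lambda}{1-\lambda}$$ is an idempotent $\mathcal{A}$-bimodule endomorphism of $\mathcal{E}\otimes_{\mathcal{A}}\mathcal{E}$ which commutes with the left and the right coaction and has range $\mathrm{Ker}(\wedge)$ and kernel $\mathcal{F}$. -/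

import Mathlib

open scoped TensorProduct

set_option linter.unusedSectionVars false

noncomputable section

namespace BicovCalc

/-! ### Bimodules over a complex algebra

An `A`-bimodule is a complex vector space `M` with commuting actions of `A` (on the left) and of
`Aᵐᵒᵖ` (on the right: `m · a` is `MulOpposite.op a • m`), both extending the action of `ℂ`. -/

section Bimodules

variable (A : Type*) [Ring A] [Algebra ℂ A]
variable (M : Type*) [AddCommGroup M] [Module ℂ M] [Module A M] [Module Aᵐᵒᵖ M]
  [IsScalarTower ℂ A M] [IsScalarTower ℂ Aᵐᵒᵖ M] [SMulCommClass A Aᵐᵒᵖ M]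
variable (N : Type*) [AddCommGroup N] [Module ℂ N] [Module A N] [Module Aᵐᵒᵖ N]
  [IsScalarTower ℂ A N] [IsScalarTower ℂ Aᵐᵒᵖ N] [SMulCommClass A Aᵐᵒᵖ N]

/-- The left multiplication `(a, m) ↦ a m`. -/
def lact : A →ₗ[ℂ] M →ₗ[ℂ] M :=
  LinearMap.mk₂ ℂ (fun a m => a • m) (fun a b m => add_smul a b m)
    (fun c a m => smul_assoc c a m) (fun a m n => smul_add a m n)
    (fun c a m => by
      rw [← algebraMap_smul A c m, ← algebraMap_smul A c (a • m), smul_smul, smul_smul,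
        Algebra.commutes])

/-- The right multiplication `(m, a) ↦ m a`. -/
def ract : M →ₗ[ℂ] A →ₗ[ℂ] M :=
  LinearMap.mk₂ ℂ (fun m a => MulOpposite.op a • m) (fun m n a => smul_add _ m n)
    (fun c m a => by
      rw [← algebraMap_smul Aᵐᵒᵖ c m, ← algebraMap_smul Aᵐᵒᵖ c (MulOpposite.op a • m),
        smul_smul, smul_smul, Algebra.commutes])
    (fun m a b => by rw [MulOpposite.op_add, add_smul])
    (fun c m a => by rw [MulOpposite.op_smul, smul_assoc])

@[simp] theorem lact_apply (a : A) (m : M) : lact A M a m = a • m := rfl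

@[simp] theorem ract_apply (m : M) (a : A) : ract A M m a = MulOpposite.op a • m := rfl

variable {M N}

/-- A linear map is a bimodule map if it commutes with both multiplications. -/
structure IsBimoduleMap (f : M →ₗ[ℂ] N) : Prop where
  map_left : ∀ (a : A) (m : M), f (a • m) = a • f m
  map_right : ∀ (a : A) (m : M), f (MulOpposite.op a • m) = MulOpposite.op a • f m

/-- An isomorphism of bimodules: a bijective bimodule map. -/
structure IsBimoduleIso (f : M →ₗ[ℂ] N) : Prop where
  isBimoduleMap : IsBimoduleMap A f
  bijective : Function.Bijective f

variable (M)

/-- A sub-bimodule. -/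
structure SubBimodule extends Submodule ℂ M where
  left_mem : ∀ (a : A) (m : M), m ∈ carrier → a • m ∈ carrier
  right_mem : ∀ (a : A) (m : M), m ∈ carrier → MulOpposite.op a • m ∈ carrier

variable {A M}

namespace SubBimodule

variable (K : SubBimodule A M)

/-- The underlying bimodule of a sub-bimodule. -/
def Carrier : Type _ := K.toSubmodule

instance : AddCommGroup K.Carrier := inferInstanceAs (AddCommGroup K.toSubmodule)
instance : Module ℂ K.Carrier := inferInstanceAs (Module ℂ K.toSubmodule)

/-- The inclusion of a sub-bimodule. -/
def incl : K.Carrier →ₗ[ℂ] M := K.toSubmodule.subtype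

theorem incl_injective : Function.Injective K.incl := Subtype.val_injective

instance : SMul A K.Carrier := ⟨fun a x => ⟨a • K.incl x, K.left_mem a _ x.2⟩⟩
instance : SMul Aᵐᵒᵖ K.Carrier :=
  ⟨fun a x => ⟨a • K.incl x, K.right_mem a.unop _ x.2⟩⟩

instance : Module A K.Carrier :=
  Function.Injective.module A K.incl.toAddMonoidHom K.incl_injective (fun _ _ => rfl)
instance : Module Aᵐᵒᵖ K.Carrier :=
  Function.Injective.module Aᵐᵒᵖ K.incl.toAddMonoidHom K.incl_injective (fun _ _ => rfl)

instance : IsScalarTower ℂ A K.Carrier :=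
  ⟨fun c a x => K.incl_injective (smul_assoc c a (K.incl x))⟩
instance : IsScalarTower ℂ Aᵐᵒᵖ K.Carrier :=
  ⟨fun c a x => K.incl_injective (smul_assoc c a (K.incl x))⟩
instance : SMulCommClass A Aᵐᵒᵖ K.Carrier :=
  ⟨fun a b x => K.incl_injective (smul_comm a b (K.incl x))⟩

/-- The quotient bimodule by a sub-bimodule. -/
def Quot : Type _ := M ⧸ K.toSubmodule

instance : AddCommGroup K.Quot := inferInstanceAs (AddCommGroup (M ⧸ K.toSubmodule))
instance : Module ℂ K.Quot := inferInstanceAs (Module ℂ (M ⧸ K.toSubmodule))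

/-- The quotient map. -/
def proj : M →ₗ[ℂ] K.Quot := K.toSubmodule.mkQ

theorem proj_surjective : Function.Surjective K.proj := K.toSubmodule.mkQ_surjective

instance : SMul A K.Quot :=
  ⟨fun a => K.toSubmodule.mapQ K.toSubmodule (lact A M a) (fun m hm => K.left_mem a m hm)⟩
instance : SMul Aᵐᵒᵖ K.Quot :=
  ⟨fun a => K.toSubmodule.mapQ K.toSubmodule ((ract A M).flip a.unop)
    (fun m hm => K.right_mem a.unop m hm)⟩

theorem proj_left (a : A) (m : M) : K.proj (a • m) = a • K.proj m := rfl
theorem proj_right (a : Aᵐᵒᵖ) (m : M) : K.proj (a • m) = a • K.proj m := rfl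

instance : Module A K.Quot :=
  Function.Surjective.module A K.proj.toAddMonoidHom K.proj_surjective (fun _ _ => rfl)
instance : Module Aᵐᵒᵖ K.Quot :=
  Function.Surjective.module Aᵐᵒᵖ K.proj.toAddMonoidHom K.proj_surjective (fun _ _ => rfl)

instance : IsScalarTower ℂ A K.Quot :=
  ⟨fun c a x => by
    obtain ⟨m, rfl⟩ := K.proj_surjective x
    rw [← proj_left, ← proj_left, smul_assoc, map_smul]⟩
instance : IsScalarTower ℂ Aᵐᵒᵖ K.Quot :=
  ⟨fun c a x => by
    obtain ⟨m, rfl⟩ := K.proj_surjective x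
    rw [← proj_right, ← proj_right, smul_assoc, map_smul]⟩
instance : SMulCommClass A Aᵐᵒᵖ K.Quot :=
  ⟨fun a b x => by
    obtain ⟨m, rfl⟩ := K.proj_surjective x
    rw [← proj_right, ← proj_left, ← proj_left, ← proj_right, smul_comm]⟩

end SubBimodule

/-! ### The tensor product `M ⊗_A N` of bimodules -/

variable (A M N)

/-- The subspace of `M ⊗_ℂ N` spanned by the elements `m a ⊗ n - m ⊗ a n`. -/
def balancedSubspace : Submodule ℂ (M ⊗[ℂ] N) :=
  Submodule.span ℂ {z | ∃ (m : M) (a : A) (n : N),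
    z = (MulOpposite.op a • m) ⊗ₜ[ℂ] n - m ⊗ₜ[ℂ] (a • n)}

/-- The tensor product `M ⊗_A N` over the (noncommutative) algebra `A`. -/
def TensorOver : Type _ := (M ⊗[ℂ] N) ⧸ balancedSubspace A M N

namespace TensorOver

instance : AddCommGroup (TensorOver A M N) :=
  inferInstanceAs (AddCommGroup ((M ⊗[ℂ] N) ⧸ balancedSubspace A M N))
instance : Module ℂ (TensorOver A M N) :=
  inferInstanceAs (Module ℂ ((M ⊗[ℂ] N) ⧸ balancedSubspace A M N))

/-- The quotient map `M ⊗_ℂ N → M ⊗_A N`. -/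
def mk : M ⊗[ℂ] N →ₗ[ℂ] TensorOver A M N := (balancedSubspace A M N).mkQ

theorem mk_surjective : Function.Surjective (mk A M N) :=
  (balancedSubspace A M N).mkQ_surjective

/-- The bilinear map `(m, n) ↦ m ⊗_A n`. -/
def tmul : M →ₗ[ℂ] N →ₗ[ℂ] TensorOver A M N := (TensorProduct.mk ℂ M N).compr₂ (mk A M N)

theorem mk_tmul (m : M) (n : N) : mk A M N (m ⊗ₜ n) = tmul A M N m n := rfl

theorem tmul_balanced (m : M) (a : A) (n : N) :
    tmul A M N (MulOpposite.op a • m) n = tmul A M N m (a • n) :=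
  (Submodule.Quotient.eq _).2 (Submodule.subset_span ⟨m, a, n, rfl⟩)

variable {A M N} in
/-- The linear map on `M ⊗_A N` induced by a balanced bilinear map. -/
def lift {P : Type*} [AddCommGroup P] [Module ℂ P] (f : M →ₗ[ℂ] N →ₗ[ℂ] P)
    (hf : ∀ (m : M) (a : A) (n : N), f (MulOpposite.op a • m) n = f m (a • n)) :
    TensorOver A M N →ₗ[ℂ] P :=
  (balancedSubspace A M N).liftQ (TensorProduct.lift f) (by
    rw [balancedSubspace, Submodule.span_le]
    rintro _ ⟨m, a, n, rfl⟩
    simp [hf])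

variable {A M N} in
@[simp] theorem lift_tmul {P : Type*} [AddCommGroup P] [Module ℂ P] (f : M →ₗ[ℂ] N →ₗ[ℂ] P)
    (hf : ∀ (m : M) (a : A) (n : N), f (MulOpposite.op a • m) n = f m (a • n))
    (m : M) (n : N) : lift f hf (tmul A M N m n) = f m n :=
  TensorProduct.lift.tmul m n

variable {A M N} in
theorem induction_on {p : TensorOver A M N → Prop} (x : TensorOver A M N)
    (zero : p 0) (tmul : ∀ m n, p (tmul A M N m n)) (add : ∀ x y, p x → p y → p (x + y)) :
    p x := by
  obtain ⟨z, rfl⟩ := mk_surjective A M N x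
  induction z with
  | zero => simpa using zero
  | tmul m n => exact tmul m n
  | add x y hx hy => rw [map_add]; exact add _ _ hx hy

/-- `a (m ⊗ n) = a m ⊗ n`. -/
instance : SMul A (TensorOver A M N) :=
  ⟨fun a => lift ((tmul A M N).comp (lact A M a)) (fun m b n => by
    simp only [LinearMap.comp_apply, lact_apply]
    rw [smul_comm, tmul_balanced])⟩

/-- `(m ⊗ n) a = m ⊗ n a`. -/
instance : SMul Aᵐᵒᵖ (TensorOver A M N) :=
  ⟨fun a => lift ((tmul A M N).compl₂ ((ract A N).flip a.unop)) (fun m b n => by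
    simp only [LinearMap.compl₂_apply, LinearMap.flip_apply, ract_apply]
    rw [tmul_balanced, smul_comm])⟩

theorem smul_tmul (a : A) (m : M) (n : N) :
    a • tmul A M N m n = tmul A M N (a • m) n := rfl

theorem op_smul_tmul (a : Aᵐᵒᵖ) (m : M) (n : N) :
    a • tmul A M N m n = tmul A M N m (a • n) := rfl

theorem left_smul_add (a : A) (x y : TensorOver A M N) : a • (x + y) = a • x + a • y :=
  map_add (lift ((tmul A M N).comp (lact A M a)) _) x y

theorem left_smul_zero (a : A) : a • (0 : TensorOver A M N) = 0 :=
  map_zero (lift ((tmul A M N).comp (lact A M a)) _)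

theorem right_smul_add (a : Aᵐᵒᵖ) (x y : TensorOver A M N) : a • (x + y) = a • x + a • y :=
  map_add (lift ((tmul A M N).compl₂ ((ract A N).flip a.unop)) _) x y

theorem right_smul_zero (a : Aᵐᵒᵖ) : a • (0 : TensorOver A M N) = 0 :=
  map_zero (lift ((tmul A M N).compl₂ ((ract A N).flip a.unop)) _)

instance : Module A (TensorOver A M N) where
  smul_add := left_smul_add A M N
  smul_zero := left_smul_zero A M N
  one_smul x := by
    induction x using induction_on with
    | zero => rw [left_smul_zero]
    | tmul m n => rw [smul_tmul, one_smul]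
    | add x y hx hy => rw [left_smul_add, hx, hy]
  mul_smul a b x := by
    induction x using induction_on with
    | zero => simp only [left_smul_zero]
    | tmul m n => rw [smul_tmul, smul_tmul, smul_tmul, mul_smul]
    | add x y hx hy => simp only [left_smul_add, hx, hy]
  add_smul a b x := by
    induction x using induction_on with
    | zero => simp only [left_smul_zero, add_zero]
    | tmul m n => rw [smul_tmul, smul_tmul, smul_tmul, add_smul, map_add, LinearMap.add_apply]
    | add x y hx hy => simp only [left_smul_add, hx, hy]; abel
  zero_smul x := by
    induction x using induction_on with
    | zero => rw [left_smul_zero]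
    | tmul m n => rw [smul_tmul, zero_smul, map_zero, LinearMap.zero_apply]
    | add x y hx hy => rw [left_smul_add, hx, hy, add_zero]

instance : Module Aᵐᵒᵖ (TensorOver A M N) where
  smul_add := right_smul_add A M N
  smul_zero := right_smul_zero A M N
  one_smul x := by
    induction x using induction_on with
    | zero => rw [right_smul_zero]
    | tmul m n => rw [op_smul_tmul, one_smul]
    | add x y hx hy => rw [right_smul_add, hx, hy]
  mul_smul a b x := by
    induction x using induction_on with
    | zero => simp only [right_smul_zero]
    | tmul m n => rw [op_smul_tmul, op_smul_tmul, op_smul_tmul, mul_smul]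
    | add x y hx hy => simp only [right_smul_add, hx, hy]
  add_smul a b x := by
    induction x using induction_on with
    | zero => simp only [right_smul_zero, add_zero]
    | tmul m n => rw [op_smul_tmul, op_smul_tmul, op_smul_tmul, add_smul, map_add]
    | add x y hx hy => simp only [right_smul_add, hx, hy]; abel
  zero_smul x := by
    induction x using induction_on with
    | zero => rw [right_smul_zero]
    | tmul m n => rw [op_smul_tmul, zero_smul, map_zero]
    | add x y hx hy => rw [right_smul_add, hx, hy, add_zero]

instance : IsScalarTower ℂ A (TensorOver A M N) :=
  ⟨fun c a x => by
    induction x using induction_on with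
    | zero => simp only [smul_zero]
    | tmul m n => rw [smul_tmul, smul_tmul, smul_assoc, map_smul, LinearMap.smul_apply]
    | add x y hx hy => simp only [smul_add, hx, hy]⟩

instance : IsScalarTower ℂ Aᵐᵒᵖ (TensorOver A M N) :=
  ⟨fun c a x => by
    induction x using induction_on with
    | zero => simp only [smul_zero]
    | tmul m n => rw [op_smul_tmul, op_smul_tmul, smul_assoc, map_smul]
    | add x y hx hy => simp only [smul_add, hx, hy]⟩

instance : SMulCommClass A Aᵐᵒᵖ (TensorOver A M N) :=
  ⟨fun a b x => by
    induction x using induction_on with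
    | zero => simp only [smul_zero]
    | tmul m n => rw [op_smul_tmul, smul_tmul, smul_tmul, op_smul_tmul]
    | add x y hx hy => simp only [smul_add, hx, hy]⟩

end TensorOver

/-! ### The `A ⊗ A`-bimodules `A ⊗ M` and `M ⊗ A` -/

/-- `(a ⊗ b) (c ⊗ m) = a c ⊗ b m`. -/
def mulAM : A ⊗[ℂ] A →ₗ[ℂ] A ⊗[ℂ] M →ₗ[ℂ] A ⊗[ℂ] M :=
  TensorProduct.map₂ (LinearMap.mul ℂ A) (lact A M)

/-- `(c ⊗ m) (a ⊗ b) = c a ⊗ m b`. -/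
def rmulAM : A ⊗[ℂ] M →ₗ[ℂ] A ⊗[ℂ] A →ₗ[ℂ] A ⊗[ℂ] M :=
  TensorProduct.map₂ (LinearMap.mul ℂ A) (ract A M)

/-- `(a ⊗ b) (m ⊗ c) = a m ⊗ b c`. -/
def mulMA : A ⊗[ℂ] A →ₗ[ℂ] M ⊗[ℂ] A →ₗ[ℂ] M ⊗[ℂ] A :=
  TensorProduct.map₂ (lact A M) (LinearMap.mul ℂ A)

/-- `(m ⊗ c) (a ⊗ b) = m a ⊗ c b`. -/
def rmulMA : M ⊗[ℂ] A →ₗ[ℂ] A ⊗[ℂ] A →ₗ[ℂ] M ⊗[ℂ] A :=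
  TensorProduct.map₂ (ract A M) (LinearMap.mul ℂ A)

/-- `(a ⊗ m, b ⊗ n) ↦ a b ⊗ (m ⊗_A n)`. -/
def legsLeft : A ⊗[ℂ] M →ₗ[ℂ] A ⊗[ℂ] N →ₗ[ℂ] A ⊗[ℂ] TensorOver A M N :=
  TensorProduct.map₂ (LinearMap.mul ℂ A) (TensorOver.tmul A M N)

/-- `(m ⊗ a, n ⊗ b) ↦ (m ⊗_A n) ⊗ a b`. -/
def legsRight : M ⊗[ℂ] A →ₗ[ℂ] N ⊗[ℂ] A →ₗ[ℂ] TensorOver A M N ⊗[ℂ] A :=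
  TensorProduct.map₂ (TensorOver.tmul A M N) (LinearMap.mul ℂ A)

variable {A M N}

theorem legsLeft_balanced (x : A ⊗[ℂ] M) (D : A ⊗[ℂ] A) (y : A ⊗[ℂ] N) :
    legsLeft A M N (rmulAM A M x D) y = legsLeft A M N x (mulAM A N D y) := by
  induction x with
  | zero => simp
  | add x x' hx hx' => simp only [map_add, LinearMap.add_apply, hx, hx']
  | tmul a m =>
    induction D with
    | zero => simp
    | add D D' h h' => simp only [map_add, LinearMap.add_apply, h, h']
    | tmul b c =>
      induction y with
      | zero => simp
      | add y y' h h' => simp only [map_add, h, h']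
      | tmul e n =>
        simp [legsLeft, rmulAM, mulAM, TensorOver.tmul_balanced, mul_assoc]

theorem legsRight_balanced (x : M ⊗[ℂ] A) (D : A ⊗[ℂ] A) (y : N ⊗[ℂ] A) :
    legsRight A M N (rmulMA A M x D) y = legsRight A M N x (mulMA A N D y) := by
  induction x with
  | zero => simp
  | add x x' hx hx' => simp only [map_add, LinearMap.add_apply, hx, hx']
  | tmul m a =>
    induction D with
    | zero => simp
    | add D D' h h' => simp only [map_add, LinearMap.add_apply, h, h']
    | tmul b c =>
      induction y with
      | zero => simp
      | add y y' h h' => simp only [map_add, h, h']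
      | tmul n e =>
        simp [legsRight, rmulMA, mulMA, TensorOver.tmul_balanced, mul_assoc]

theorem mulAM_mul (D D' : A ⊗[ℂ] A) (x : A ⊗[ℂ] M) :
    mulAM A M (D * D') x = mulAM A M D (mulAM A M D' x) := by
  induction D with
  | zero => simp
  | add D₁ D₂ h h' => simp only [add_mul, map_add, LinearMap.add_apply, h, h']
  | tmul b c =>
    induction D' with
    | zero => simp
    | add D₁ D₂ h h' => simp only [mul_add, map_add, LinearMap.add_apply, h, h']
    | tmul b' c' =>
      induction x with
      | zero => simp
      | add y y' h h' => simp only [map_add, h, h']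
      | tmul e n => simp [mulAM, mul_assoc, mul_smul]

theorem mulMA_mul (D D' : A ⊗[ℂ] A) (x : M ⊗[ℂ] A) :
    mulMA A M (D * D') x = mulMA A M D (mulMA A M D' x) := by
  induction D with
  | zero => simp
  | add D₁ D₂ h h' => simp only [add_mul, map_add, LinearMap.add_apply, h, h']
  | tmul b c =>
    induction D' with
    | zero => simp
    | add D₁ D₂ h h' => simp only [mul_add, map_add, LinearMap.add_apply, h, h']
    | tmul b' c' =>
      induction x with
      | zero => simp
      | add y y' h h' => simp only [map_add, h, h']
      | tmul e n => simp [mulMA, mul_assoc, mul_smul]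

theorem mulAM_rmulAM (D D' : A ⊗[ℂ] A) (x : A ⊗[ℂ] M) :
    rmulAM A M (mulAM A M D x) D' = mulAM A M D (rmulAM A M x D') := by
  induction D with
  | zero => simp
  | add D₁ D₂ h h' => simp only [map_add, LinearMap.add_apply, h, h']
  | tmul b c =>
    induction D' with
    | zero => simp
    | add D₁ D₂ h h' => simp only [map_add, h, h']
    | tmul b' c' =>
      induction x with
      | zero => simp
      | add y y' h h' => simp only [map_add, LinearMap.add_apply, h, h']
      | tmul e n => simp [mulAM, rmulAM, mul_assoc, smul_comm]

theorem mulMA_rmulMA (D D' : A ⊗[ℂ] A) (x : M ⊗[ℂ] A) :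
    rmulMA A M (mulMA A M D x) D' = mulMA A M D (rmulMA A M x D') := by
  induction D with
  | zero => simp
  | add D₁ D₂ h h' => simp only [map_add, LinearMap.add_apply, h, h']
  | tmul b c =>
    induction D' with
    | zero => simp
    | add D₁ D₂ h h' => simp only [map_add, h, h']
    | tmul b' c' =>
      induction x with
      | zero => simp
      | add y y' h h' => simp only [map_add, LinearMap.add_apply, h, h']
      | tmul e n => simp [mulMA, rmulMA, mul_assoc, smul_comm]

end Bimodules

/-! ### Bicovariant first order differential calculi -/

section Calculus

variable (A : Type*) [Ring A] [HopfAlgebra ℂ A]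
variable (E : Type*) [AddCommGroup E] [Module ℂ E] [Module A E] [Module Aᵐᵒᵖ E]
  [IsScalarTower ℂ A E] [IsScalarTower ℂ Aᵐᵒᵖ E] [SMulCommClass A Aᵐᵒᵖ E]

/-- A bicovariant first order differential calculus `(E, d)` over the Hopf algebra `A`. -/
structure BicovariantCalculus where
  d : A →ₗ[ℂ] E
  leibniz : ∀ a b : A, d (a * b) = MulOpposite.op b • d a + a • d b
  exists_sum : ∀ ρ : E, ∃ (K : ℕ) (a b : Fin K → A), ρ = ∑ k, a k • d (b k)
  left_covariant : ∀ (K : ℕ) (a b : Fin K → A), ∑ k, a k • d (b k) = 0 →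
    ∑ k, mulAM A E (Coalgebra.comul (R := ℂ) (a k))
      (d.lTensor A (Coalgebra.comul (R := ℂ) (b k))) = 0
  right_covariant : ∀ (K : ℕ) (a b : Fin K → A), ∑ k, a k • d (b k) = 0 →
    ∑ k, mulMA A E (Coalgebra.comul (R := ℂ) (a k))
      (d.rTensor A (Coalgebra.comul (R := ℂ) (b k))) = 0

namespace BicovariantCalculus

variable {A E}
variable (C : BicovariantCalculus A E)

/-- The linear map `a ⊗ b ↦ a d b`. -/
def adb : A ⊗[ℂ] A →ₗ[ℂ] E := TensorProduct.lift ((lact A E).compl₂ C.d)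

/-- The linear map `a ⊗ b ↦ Δ(a) (id ⊗ d)Δ(b)`. -/
def preLeft : A ⊗[ℂ] A →ₗ[ℂ] A ⊗[ℂ] E :=
  TensorProduct.lift ((mulAM A E).compl₁₂ (Coalgebra.comul (R := ℂ) (A := A))
    (C.d.lTensor A ∘ₗ Coalgebra.comul (R := ℂ) (A := A)))

/-- The linear map `a ⊗ b ↦ Δ(a) (d ⊗ id)Δ(b)`. -/
def preRight : A ⊗[ℂ] A →ₗ[ℂ] E ⊗[ℂ] A :=
  TensorProduct.lift ((mulMA A E).compl₁₂ (Coalgebra.comul (R := ℂ) (A := A))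
    (C.d.rTensor A ∘ₗ Coalgebra.comul (R := ℂ) (A := A)))

theorem adb_surjective : Function.Surjective C.adb := by
  intro ρ
  obtain ⟨K, a, b, rfl⟩ := C.exists_sum ρ
  exact ⟨∑ k, a k ⊗ₜ b k, by simp [adb]⟩

theorem exists_fin_sum (z : A ⊗[ℂ] A) :
    ∃ (K : ℕ) (a b : Fin K → A), z = ∑ k, a k ⊗ₜ[ℂ] b k := by
  induction z with
  | zero => exact ⟨0, Fin.elim0, Fin.elim0, by simp⟩
  | tmul x y => exact ⟨1, fun _ => x, fun _ => y, by simp⟩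
  | add z w hz hw =>
    obtain ⟨K, a, b, rfl⟩ := hz
    obtain ⟨L, a', b', rfl⟩ := hw
    exact ⟨K + L, Fin.append a a', Fin.append b b', by simp [Fin.sum_univ_add]⟩

theorem ker_adb_le_left : LinearMap.ker C.adb ≤ LinearMap.ker C.preLeft := by
  intro z hz
  obtain ⟨K, a, b, rfl⟩ := exists_fin_sum z
  have := C.left_covariant K a b (by simpa [adb] using hz)
  simpa [preLeft] using this

theorem ker_adb_le_right : LinearMap.ker C.adb ≤ LinearMap.ker C.preRight := by
  intro z hz
  obtain ⟨K, a, b, rfl⟩ := exists_fin_sum z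
  have := C.right_covariant K a b (by simpa [adb] using hz)
  simpa [preRight] using this

/-- The left coaction `E → A ⊗ E`, `a d b ↦ Δ(a) (id ⊗ d)Δ(b)`. -/
def coactL : E →ₗ[ℂ] A ⊗[ℂ] E :=
  (LinearMap.ker C.adb).liftQ C.preLeft C.ker_adb_le_left ∘ₗ
    (C.adb.quotKerEquivOfSurjective C.adb_surjective).symm.toLinearMap

/-- The right coaction `E → E ⊗ A`, `a d b ↦ Δ(a) (d ⊗ id)Δ(b)`. -/
def coactR : E →ₗ[ℂ] E ⊗[ℂ] A :=
  (LinearMap.ker C.adb).liftQ C.preRight C.ker_adb_le_right ∘ₗ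
    (C.adb.quotKerEquivOfSurjective C.adb_surjective).symm.toLinearMap

theorem coactL_adb (z : A ⊗[ℂ] A) : C.coactL (C.adb z) = C.preLeft z := by
  have : (C.adb.quotKerEquivOfSurjective C.adb_surjective).symm (C.adb z) =
      Submodule.Quotient.mk z := by
    rw [LinearEquiv.symm_apply_eq]; rfl
  simp [coactL, this]

theorem coactR_adb (z : A ⊗[ℂ] A) : C.coactR (C.adb z) = C.preRight z := by
  have : (C.adb.quotKerEquivOfSurjective C.adb_surjective).symm (C.adb z) =
      Submodule.Quotient.mk z := by
    rw [LinearEquiv.symm_apply_eq]; rfl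
  simp [coactR, this]

theorem coactL_smul_d (a b : A) : C.coactL (a • C.d b) =
    mulAM A E (Coalgebra.comul (R := ℂ) a) (C.d.lTensor A (Coalgebra.comul (R := ℂ) b)) := by
  simpa [adb, preLeft] using C.coactL_adb (a ⊗ₜ b)

theorem coactR_smul_d (a b : A) : C.coactR (a • C.d b) =
    mulMA A E (Coalgebra.comul (R := ℂ) a) (C.d.rTensor A (Coalgebra.comul (R := ℂ) b)) := by
  simpa [adb, preRight] using C.coactR_adb (a ⊗ₜ b)

theorem induction_smul_d {p : E → Prop} (e : E) (zero : p 0)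
    (smul_d : ∀ a b : A, p (a • C.d b)) (add : ∀ x y, p x → p y → p (x + y)) : p e := by
  obtain ⟨z, rfl⟩ := C.adb_surjective e
  induction z with
  | zero => simpa using zero
  | tmul a b => simpa [adb] using smul_d a b
  | add x y hx hy => rw [map_add]; exact add _ _ hx hy

theorem lTensor_d_mul (D D' : A ⊗[ℂ] A) : C.d.lTensor A (D * D') =
    rmulAM A E (C.d.lTensor A D) D' + mulAM A E D (C.d.lTensor A D') := by
  induction D with
  | zero => simp
  | add D₁ D₂ h h' => simp only [add_mul, map_add, LinearMap.add_apply, h, h']; abel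
  | tmul b c =>
    induction D' with
    | zero => simp
    | add D₁ D₂ h h' => simp only [mul_add, map_add, h, h']; abel
    | tmul b' c' => simp [rmulAM, mulAM, C.leibniz, TensorProduct.tmul_add]

theorem rTensor_d_mul (D D' : A ⊗[ℂ] A) : C.d.rTensor A (D * D') =
    rmulMA A E (C.d.rTensor A D) D' + mulMA A E D (C.d.rTensor A D') := by
  induction D with
  | zero => simp
  | add D₁ D₂ h h' => simp only [add_mul, map_add, LinearMap.add_apply, h, h']; abel
  | tmul b c =>
    induction D' with
    | zero => simp
    | add D₁ D₂ h h' => simp only [mul_add, map_add, h, h']; abel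
    | tmul b' c' => simp [rmulMA, mulMA, C.leibniz, TensorProduct.add_tmul]

theorem coactL_left (a : A) (e : E) :
    C.coactL (a • e) = mulAM A E (Coalgebra.comul (R := ℂ) a) (C.coactL e) := by
  induction e using C.induction_smul_d with
  | zero => simp
  | add x y hx hy => simp only [smul_add, map_add, hx, hy]
  | smul_d b c =>
    rw [smul_smul, coactL_smul_d, coactL_smul_d, Bialgebra.comul_mul, mulAM_mul]

theorem coactR_left (a : A) (e : E) :
    C.coactR (a • e) = mulMA A E (Coalgebra.comul (R := ℂ) a) (C.coactR e) := by
  induction e using C.induction_smul_d with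
  | zero => simp
  | add x y hx hy => simp only [smul_add, map_add, hx, hy]
  | smul_d b c =>
    rw [smul_smul, coactR_smul_d, coactR_smul_d, Bialgebra.comul_mul, mulMA_mul]

theorem op_smul_d (a b c : A) :
    MulOpposite.op a • b • C.d c = b • C.d (c * a) - (b * c) • C.d a := by
  rw [C.leibniz, smul_add, smul_smul, add_sub_cancel_right, smul_comm b (MulOpposite.op a)]

theorem coactL_right (a : A) (e : E) : C.coactL (MulOpposite.op a • e) =
    rmulAM A E (C.coactL e) (Coalgebra.comul (R := ℂ) a) := by
  induction e using C.induction_smul_d with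
  | zero => simp
  | add x y hx hy => simp only [smul_add, map_add, LinearMap.add_apply, hx, hy]
  | smul_d b c =>
    rw [op_smul_d, map_sub, coactL_smul_d, coactL_smul_d, coactL_smul_d, Bialgebra.comul_mul,
      Bialgebra.comul_mul, lTensor_d_mul, map_add, mulAM_mul, add_sub_cancel_right,
      mulAM_rmulAM]

theorem coactR_right (a : A) (e : E) : C.coactR (MulOpposite.op a • e) =
    rmulMA A E (C.coactR e) (Coalgebra.comul (R := ℂ) a) := by
  induction e using C.induction_smul_d with
  | zero => simp
  | add x y hx hy => simp only [smul_add, map_add, LinearMap.add_apply, hx, hy]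
  | smul_d b c =>
    rw [op_smul_d, map_sub, coactR_smul_d, coactR_smul_d, coactR_smul_d, Bialgebra.comul_mul,
      Bialgebra.comul_mul, rTensor_d_mul, map_add, mulMA_mul, add_sub_cancel_right,
      mulMA_rmulMA]

/-- The bimodule `E ⊗_A E` of two-tensors. -/
abbrev TwoTensor (_C : BicovariantCalculus A E) : Type _ := TensorOver A E E

/-- The left coaction on `E ⊗_A E`:
`e ⊗ f ↦ e₍₋₁₎ f₍₋₁₎ ⊗ (e₍₀₎ ⊗ f₍₀₎)`. -/
def coactL₂ : C.TwoTensor →ₗ[ℂ] A ⊗[ℂ] C.TwoTensor :=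
  TensorOver.lift ((legsLeft A E E).compl₁₂ C.coactL C.coactL) (fun m a n => by
    simp only [LinearMap.compl₁₂_apply, coactL_right, coactL_left, legsLeft_balanced])

/-- The right coaction on `E ⊗_A E`:
`e ⊗ f ↦ (e₍₀₎ ⊗ f₍₀₎) ⊗ e₍₁₎ f₍₁₎`. -/
def coactR₂ : C.TwoTensor →ₗ[ℂ] C.TwoTensor ⊗[ℂ] A :=
  TensorOver.lift ((legsRight A E E).compl₁₂ C.coactR C.coactR) (fun m a n => by
    simp only [LinearMap.compl₁₂_apply, coactR_right, coactR_left, legsRight_balanced])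

/-- The left-invariant one-forms `₀E = {e | Δ_E e = 1 ⊗ e}`. -/
def leftInv : Submodule ℂ E :=
  LinearMap.eqLocus C.coactL (TensorProduct.mk ℂ A E 1)

/-- The right-invariant one-forms `E₀ = {e | _EΔ e = e ⊗ 1}`. -/
def rightInv : Submodule ℂ E :=
  LinearMap.eqLocus C.coactR ((TensorProduct.mk ℂ E A).flip 1)

/-- The left-invariant two-tensors `₀(E ⊗_A E)`, which the multiplication identifies with
`₀E ⊗_ℂ ₀E`. -/
def leftInv₂ : Submodule ℂ C.TwoTensor :=
  LinearMap.eqLocus C.coactL₂ (TensorProduct.mk ℂ A C.TwoTensor 1)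

/-- A linear endomorphism of `E ⊗_A E` is bicovariant if it commutes with both coactions. -/
structure IsBicovariant (f : Module.End ℂ C.TwoTensor) : Prop where
  left : C.coactL₂ ∘ₗ f = f.lTensor A ∘ₗ C.coactL₂
  right : C.coactR₂ ∘ₗ f = f.rTensor A ∘ₗ C.coactR₂

/-- The defining property of the canonical braiding `σ`: it is a bimodule endomorphism with
`σ(ω ⊗ η) = η ⊗ ω` for left-invariant `ω` and right-invariant `η`. -/
structure IsBraiding (σ : Module.End ℂ C.TwoTensor) : Prop where
  isBimoduleMap : IsBimoduleMap A σ
  swap : ∀ ω ∈ C.leftInv, ∀ η ∈ C.rightInv,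
    σ (TensorOver.tmul A E E ω η) = TensorOver.tmul A E E η ω

variable {C}

/-- The sub-bimodule `Ker(σ - 1)` of `E ⊗_A E`. -/
def IsBraiding.kerSubOne {σ : Module.End ℂ C.TwoTensor} (hσ : C.IsBraiding σ) :
    SubBimodule A C.TwoTensor where
  toSubmodule := LinearMap.ker (σ - 1)
  left_mem a m hm := by
    have h : σ m = m := sub_eq_zero.1 hm
    change σ (a • m) - a • m = 0
    rw [hσ.isBimoduleMap.map_left, h, sub_self]
  right_mem a m hm := by
    have h : σ m = m := sub_eq_zero.1 hm
    change σ (MulOpposite.op a • m) - MulOpposite.op a • m = 0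
    rw [hσ.isBimoduleMap.map_right, h, sub_self]

/-- The bimodule of two-forms `Ω²(A) = (E ⊗_A E) / Ker(σ - 1)`. -/
abbrev IsBraiding.TwoForm {σ : Module.End ℂ C.TwoTensor} (hσ : C.IsBraiding σ) : Type _ :=
  hσ.kerSubOne.Quot

/-- The wedge map, i.e. the quotient map `∧ : E ⊗_A E → Ω²(A)`. -/
def IsBraiding.wedge {σ : Module.End ℂ C.TwoTensor} (hσ : C.IsBraiding σ) :
    C.TwoTensor →ₗ[ℂ] hσ.TwoForm :=
  hσ.kerSubOne.proj

end BicovariantCalculus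

/-! ### Diagonalisability -/

/-- An endomorphism is diagonalisable if its eigenspaces span the whole space. -/
def IsDiagonalisable {V : Type*} [AddCommGroup V] [Module ℂ V] (f : Module.End ℂ V) : Prop :=
  ⨆ μ : ℂ, f.eigenspace μ = ⊤

/-- For an endomorphism `f` of a subspace `V` of `W`, the sum, as a subspace of `W`, of the
eigenspaces of `f` for the eigenvalues different from `1`. -/
def eigenSumNeOne {W : Type*} [AddCommGroup W] [Module ℂ W] {V : Submodule ℂ W}
    (f : Module.End ℂ V) : Submodule ℂ W :=
  (⨆ (μ : ℂ) (_ : μ ≠ 1), f.eigenspace μ).map V.subtype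

end Calculus

end BicovCalc

end

/-! The convolution identities of the antipode show that S(b₁) d b₂ is left-invariant and d b₁ S(b₂)
right-invariant. Hence E = A · ₀E = E₀ · A (`span_leftInv`, `span_rightInv`), and E ⊗_A E is spanned
by the elements a (ω ⊗ η) b with ω left-invariant and η right-invariant. This gives uniqueness of σ.
Existence comes from an explicit formula built from m ↦ S(m₍₋₁₎) m₍₀₎ (`invProj`) and the right
adjoint action m ◁ a = S(a₁) m a₂ (`adjAct`), which are linked by `invProj_op_smul`.

Since the two coactions commute (`coactL_coactR`), the left coaction of a right-invariant form has
its second leg in E₀, and symmetrically. So σ can be compared with both coactions on the spanning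
elements (`IsBraiding.isBicovariant`), and it preserves ₀(E ⊗_A E). That space is the span of the
products of left-invariant forms (`leftInv₂_eq`), so it is finite-dimensional and generates E ⊗_A E
over A.

If ₀σ is diagonalisable, splitting the generators into eigenvectors gives E ⊗_A E = Ker(σ - 1) + A ·
₀F (`ker_sub_one_sup_eq_top`). The polynomial P in σ that takes the value 1 at 1 and vanishes at the
other eigenvalues is the identity on the first summand and zero on the second. So the sum is direct,
and P is the projection onto Ker(σ - 1) = Ker(∧) with kernel A · ₀F. As a polynomial in σ it is a
bimodule map and commutes with the coactions, so F = Ker P is a sub-bimodule. The other description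
F = ₀F · A rests on S(a) w = (w ◁ a₁) S(a₂), because ₀F is stable under ◁. -/

noncomputable section

namespace BicovCalc

open Coalgebra HopfAlgebra WithConv

/-! ### The convolution action -/

section Convolution

variable {A : Type*} [AddCommGroup A] [Module ℂ A] [Coalgebra ℂ A]
variable {N : Type*} [AddCommMonoid N] [Module ℂ N] {N' : Type*} [AddCommMonoid N'] [Module ℂ N']

section Linear

variable {B : Type*} [AddCommMonoid B] [Module ℂ B] {B' : Type*} [AddCommMonoid B'] [Module ℂ B']

theorem lift_comul (f : A →ₗ[ℂ] A →ₗ[ℂ] N) (a : A) :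
    TensorProduct.lift f (comul (R := ℂ) a) =
      ∑ i ∈ (ℛ ℂ a).index, f ((ℛ ℂ a).left i) ((ℛ ℂ a).right i) := by
  conv_lhs => rw [← (ℛ ℂ a).eq]
  simp

/-- Coassociativity for an arbitrary trilinear expression in Sweedler notation: the linear map
induced by `f` is applied to the identity in the triple tensor product. -/
theorem sum_coassoc (f : A →ₗ[ℂ] A →ₗ[ℂ] A →ₗ[ℂ] N) (a : A) :
    ∑ i ∈ (ℛ ℂ a).index, ∑ j ∈ (ℛ ℂ ((ℛ ℂ a).left i)).index,
      f ((ℛ ℂ ((ℛ ℂ a).left i)).left j) ((ℛ ℂ ((ℛ ℂ a).left i)).right j) ((ℛ ℂ a).right i) =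
    ∑ i ∈ (ℛ ℂ a).index, ∑ j ∈ (ℛ ℂ ((ℛ ℂ a).right i)).index,
      f ((ℛ ℂ a).left i) ((ℛ ℂ ((ℛ ℂ a).right i)).left j)
        ((ℛ ℂ ((ℛ ℂ a).right i)).right j) := by
  have h := congrArg (TensorProduct.lift
      ((TensorProduct.uncurry (RingHom.id ℂ) A A N) ∘ₗ f))
    (sum_tmul_tmul_eq (R := ℂ) (ℛ ℂ a) (fun i => ℛ ℂ ((ℛ ℂ a).left i))
      (fun i => ℛ ℂ ((ℛ ℂ a).right i)))
  simpa using h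

/-- The convolution `a ↦ φ(a₁) g(a₂)` of `φ : A → B` with `g : A → N`, where `B` acts on `N` by
`act`. -/
def convLeft (act : B →ₗ[ℂ] N →ₗ[ℂ] N) (φ : A →ₗ[ℂ] B) (g : A →ₗ[ℂ] N) : A →ₗ[ℂ] N :=
  TensorProduct.lift (act.compl₁₂ φ g) ∘ₗ comul

/-- The convolution `a ↦ g(a₁) φ(a₂)` of `g : A → N` with `φ : A → B`, where `B` acts on `N` from
the right by `act`. -/
def convRight (act : N →ₗ[ℂ] B →ₗ[ℂ] N) (g : A →ₗ[ℂ] N) (φ : A →ₗ[ℂ] B) : A →ₗ[ℂ] N :=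
  TensorProduct.lift (act.compl₁₂ g φ) ∘ₗ comul

theorem convLeft_apply (act : B →ₗ[ℂ] N →ₗ[ℂ] N) (φ : A →ₗ[ℂ] B) (g : A →ₗ[ℂ] N) (a : A) :
    convLeft act φ g a =
      ∑ i ∈ (ℛ ℂ a).index, act (φ ((ℛ ℂ a).left i)) (g ((ℛ ℂ a).right i)) := by
  simp [convLeft, lift_comul]

theorem convRight_apply (act : N →ₗ[ℂ] B →ₗ[ℂ] N) (g : A →ₗ[ℂ] N) (φ : A →ₗ[ℂ] B) (a : A) :
    convRight act g φ a =
      ∑ i ∈ (ℛ ℂ a).index, act (g ((ℛ ℂ a).left i)) (φ ((ℛ ℂ a).right i)) := by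
  simp [convRight, lift_comul]

/-- Used with `k` a coaction or an embedding of E into A ⊗ E, and `u` the corresponding map A → A ⊗
A. This turns invariance of a form into an identity between convolutions. -/
theorem comp_convLeft {act : B →ₗ[ℂ] N →ₗ[ℂ] N} {act' : B' →ₗ[ℂ] N' →ₗ[ℂ] N'}
    (u : B →ₗ[ℂ] B') (k : N →ₗ[ℂ] N') (h : ∀ b n, k (act b n) = act' (u b) (k n))
    (φ : A →ₗ[ℂ] B) (g : A →ₗ[ℂ] N) :
    k ∘ₗ convLeft act φ g = convLeft act' (u ∘ₗ φ) (k ∘ₗ g) := by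
  ext a
  simp [convLeft_apply, h]

theorem comp_convRight {act : N →ₗ[ℂ] B →ₗ[ℂ] N} {act' : N' →ₗ[ℂ] B' →ₗ[ℂ] N'}
    (u : B →ₗ[ℂ] B') (k : N →ₗ[ℂ] N') (h : ∀ n b, k (act n b) = act' (k n) (u b))
    (g : A →ₗ[ℂ] N) (φ : A →ₗ[ℂ] B) :
    k ∘ₗ convRight act g φ = convRight act' (k ∘ₗ g) (u ∘ₗ φ) := by
  ext a
  simp [convRight_apply, h]

end Linear

variable {B : Type*} [Semiring B] [Algebra ℂ B]

/-- Together with `convLeft_one`, this makes the maps A → N a left module over the convolution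
algebra of maps A → B. Antipode cancellations then become products in that algebra. -/
theorem convLeft_convLeft (act : B →ₗ[ℂ] N →ₗ[ℂ] N)
    (hact : ∀ x y n, act (x * y) n = act x (act y n)) (φ ψ : A →ₗ[ℂ] B) (g : A →ₗ[ℂ] N) :
    convLeft act φ (convLeft act ψ g) = convLeft act (toConv φ * toConv ψ).ofConv g := by
  ext a
  simp only [convLeft_apply, map_sum]
  have h := sum_coassoc
    (((LinearMap.mul ℂ B).compl₁₂ φ ψ).compr₂ ((LinearMap.lcomp ℂ N g) ∘ₗ act)) a
  simp only [LinearMap.compr₂_apply, LinearMap.compl₁₂_apply, LinearMap.comp_apply,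
    LinearMap.mul_apply', LinearMap.lcomp_apply, hact] at h
  rw [← h]
  refine Finset.sum_congr rfl fun i _ => ?_
  have h' := (ℛ ℂ ((ℛ ℂ a).left i)).convMul_apply (toConv φ) (toConv ψ)
  change (toConv φ * toConv ψ).ofConv _ = _ at h'
  rw [h']
  simp [hact]

theorem convRight_convRight (act : N →ₗ[ℂ] B →ₗ[ℂ] N)
    (hact : ∀ n x y, act n (x * y) = act (act n x) y) (g : A →ₗ[ℂ] N) (φ ψ : A →ₗ[ℂ] B) :
    convRight act (convRight act g φ) ψ = convRight act g (toConv φ * toConv ψ).ofConv := by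
  ext a
  simp only [convRight_apply, map_sum, LinearMap.sum_apply]
  have h := sum_coassoc
    ((LinearMap.llcomp ℂ A N _ ((LinearMap.lcomp ℂ N ψ) ∘ₗ act)) ∘ₗ (act.compl₁₂ g φ)) a
  simp only [LinearMap.compl₁₂_apply, LinearMap.comp_apply, LinearMap.llcomp_apply,
    LinearMap.lcomp_apply] at h
  rw [h]
  refine Finset.sum_congr rfl fun i _ => ?_
  have h' := (ℛ ℂ ((ℛ ℂ a).right i)).convMul_apply (toConv φ) (toConv ψ)
  change (toConv φ * toConv ψ).ofConv _ = _ at h'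
  rw [h']
  simp [hact]

theorem convLeft_convLeft_of_eq (act : B →ₗ[ℂ] N →ₗ[ℂ] N)
    (hact : ∀ x y n, act (x * y) n = act x (act y n)) {φ ψ χ : A →ₗ[ℂ] B}
    (h : toConv φ * toConv ψ = toConv χ) (g : A →ₗ[ℂ] N) :
    convLeft act φ (convLeft act ψ g) = convLeft act χ g := by
  rw [convLeft_convLeft act hact, h]

theorem convRight_convRight_of_eq (act : N →ₗ[ℂ] B →ₗ[ℂ] N)
    (hact : ∀ n x y, act n (x * y) = act (act n x) y) {φ ψ χ : A →ₗ[ℂ] B}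
    (h : toConv φ * toConv ψ = toConv χ) (g : A →ₗ[ℂ] N) :
    convRight act (convRight act g φ) ψ = convRight act g χ := by
  rw [convRight_convRight act hact, h]

theorem convLeft_one (act : B →ₗ[ℂ] N →ₗ[ℂ] N) (hact : ∀ n, act 1 n = n) (g : A →ₗ[ℂ] N) :
    convLeft act (1 : WithConv (A →ₗ[ℂ] B)).ofConv g = g := by
  ext a
  rw [convLeft_apply]
  conv_rhs => rw [← sum_counit_smul (R := ℂ) (ℛ ℂ a)]
  simp [LinearMap.convOne_def, Algebra.algebraMap_eq_smul_one, hact]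

theorem sum_smul_counit (a : A) :
    ∑ i ∈ (ℛ ℂ a).index, counit (R := ℂ) ((ℛ ℂ a).right i) • (ℛ ℂ a).left i = a := by
  simpa only [map_sum, TensorProduct.lift.tmul, LinearMap.flip_apply, LinearMap.lsmul_apply,
    one_smul] using congrArg (TensorProduct.lift (LinearMap.lsmul ℂ A).flip)
    (sum_tmul_counit_eq (R := ℂ) (ℛ ℂ a))

theorem convRight_one (act : N →ₗ[ℂ] B →ₗ[ℂ] N) (hact : ∀ n, act n 1 = n) (g : A →ₗ[ℂ] N) :
    convRight act g (1 : WithConv (A →ₗ[ℂ] B)).ofConv = g := by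
  ext a
  rw [convRight_apply]
  conv_rhs => rw [← sum_smul_counit a]
  simp [LinearMap.convOne_def, Algebra.algebraMap_eq_smul_one, hact]

end Convolution

/-! ### The antipode and the coproduct -/

section Antipode

variable {A : Type*} [Ring A] [HopfAlgebra ℂ A]

/-- The embedding `a ↦ a ⊗ 1`. -/
def inlTensor : A →ₗ[ℂ] A ⊗[ℂ] A := (TensorProduct.mk ℂ A A).flip 1

/-- The embedding `a ↦ 1 ⊗ a`. -/
def inrTensor : A →ₗ[ℂ] A ⊗[ℂ] A := TensorProduct.mk ℂ A A 1

@[simp] theorem inlTensor_apply (a : A) : inlTensor a = a ⊗ₜ[ℂ] (1 : A) := rfl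

@[simp] theorem inrTensor_apply (a : A) : inrTensor a = (1 : A) ⊗ₜ[ℂ] a := rfl

theorem conv_inlTensor_inrTensor :
    toConv (inlTensor (A := A)) * toConv inrTensor = toConv (comul (R := ℂ) (A := A)) := by
  ext a
  rw [(ℛ ℂ a).convMul_apply]
  simpa using (ℛ ℂ a).eq

/-- Composition with an algebra map respects convolution, so it carries id * S = 1 to this identity.
For h = Δ it exhibits Δ ∘ S as a convolution inverse of Δ. -/
theorem conv_comp_antipode {B : Type*} [Ring B] [Algebra ℂ B] (h : A →ₐ[ℂ] B) :
    toConv h.toLinearMap * toConv (h.toLinearMap ∘ₗ antipode ℂ) = 1 := by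
  have := LinearMap.algHom_comp_convMul_distrib h (toConv LinearMap.id)
    (toConv (antipode ℂ (A := A)))
  rw [LinearMap.id_mul_antipode] at this
  apply WithConv.ofConv_injective
  refine this.symm.trans ?_
  ext; simp [LinearMap.convOne_def]

theorem conv_antipode_comp {B : Type*} [Ring B] [Algebra ℂ B] (h : A →ₐ[ℂ] B) :
    toConv (h.toLinearMap ∘ₗ antipode ℂ) * toConv h.toLinearMap = 1 := by
  have := LinearMap.algHom_comp_convMul_distrib h (toConv (antipode ℂ (A := A)))
    (toConv LinearMap.id)
  rw [LinearMap.antipode_mul_id] at this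
  apply WithConv.ofConv_injective
  refine this.symm.trans ?_
  ext; simp [LinearMap.convOne_def]

/-- `Δ(S(a₁)) (a₂ ⊗ 1) = 1 ⊗ S(a)`. -/
theorem conv_comul_antipode_inlTensor :
    toConv (comul (R := ℂ) ∘ₗ antipode ℂ) * toConv (inlTensor (A := A)) =
      toConv (inrTensor ∘ₗ antipode ℂ) := by
  have h₁ := conv_antipode_comp (Bialgebra.comulAlgHom ℂ A)
  have h₂ := conv_comp_antipode (Algebra.TensorProduct.includeRight (R := ℂ) (A := A) (B := A))
  change toConv (comul (R := ℂ) ∘ₗ antipode ℂ) * toConv (comul (R := ℂ) (A := A)) = 1 at h₁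
  change toConv inrTensor * toConv (inrTensor ∘ₗ antipode ℂ) = 1 at h₂
  rw [← conv_inlTensor_inrTensor, ← mul_assoc] at h₁
  -- As Δ = `inlTensor` * `inrTensor`, the product (Δ ∘ S) * `inlTensor` is a left inverse of
  -- `inrTensor`. It therefore equals the right inverse `inrTensor` ∘ S.
  exact left_inv_eq_right_inv h₁ h₂

/-- `(1 ⊗ a₁) Δ(S(a₂)) = S(a) ⊗ 1`. -/
theorem conv_inrTensor_comul_antipode :
    toConv (inrTensor (A := A)) * toConv (comul (R := ℂ) ∘ₗ antipode ℂ) =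
      toConv (inlTensor ∘ₗ antipode ℂ) := by
  have h₁ := conv_comp_antipode (Bialgebra.comulAlgHom ℂ A)
  have h₂ := conv_antipode_comp
    (Algebra.TensorProduct.includeLeft (R := ℂ) (S := ℂ) (A := A) (B := A))
  change toConv (comul (R := ℂ) (A := A)) * toConv (comul (R := ℂ) ∘ₗ antipode ℂ) = 1 at h₁
  change toConv (inlTensor ∘ₗ antipode ℂ) * toConv inlTensor = 1 at h₂
  rw [← conv_inlTensor_inrTensor, mul_assoc] at h₁
  exact (left_inv_eq_right_inv h₂ h₁).symm

end Antipode

/-! ### The adjoint action and the projection onto the invariant elements -/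

section Bimodule

variable {A : Type*} [Ring A] [HopfAlgebra ℂ A]
variable {M : Type*} [AddCommGroup M] [Module ℂ M] [Module A M] [Module Aᵐᵒᵖ M]
  [IsScalarTower ℂ A M] [IsScalarTower ℂ Aᵐᵒᵖ M] [SMulCommClass A Aᵐᵒᵖ M]

theorem lact_mul (x y : A) (m : M) : lact A M (x * y) m = lact A M x (lact A M y m) :=
  mul_smul x y m

theorem ract_mul (m : M) (x y : A) : ract A M m (x * y) = ract A M (ract A M m x) y := by
  simp [mul_smul]

theorem rmulMA_mul (x : M ⊗[ℂ] A) (D D' : A ⊗[ℂ] A) :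
    rmulMA A M x (D * D') = rmulMA A M (rmulMA A M x D) D' := by
  induction D with
  | zero => simp
  | add D₁ D₂ h h' => simp only [add_mul, map_add, LinearMap.add_apply, h, h']
  | tmul b c =>
    induction D' with
    | zero => simp
    | add D₁ D₂ h h' => simp only [mul_add, map_add, h, h']
    | tmul b' c' =>
      induction x with
      | zero => simp
      | add y y' h h' => simp only [map_add, LinearMap.add_apply, h, h']
      | tmul n e => simp [rmulMA, mul_assoc, mul_smul]

theorem mulAM_one (x : A ⊗[ℂ] M) : mulAM A M 1 x = x := by
  induction x with
  | zero => simp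
  | add y y' h h' => simp only [map_add, h, h']
  | tmul e n => simp [mulAM, Algebra.TensorProduct.one_def]

theorem mulMA_one (x : M ⊗[ℂ] A) : mulMA A M 1 x = x := by
  induction x with
  | zero => simp
  | add y y' h h' => simp only [map_add, h, h']
  | tmul e n => simp [mulMA, Algebra.TensorProduct.one_def]

/-- The right adjoint action `m ◁ a = S(a₁) m a₂`. -/
def adjAct : M →ₗ[ℂ] A →ₗ[ℂ] M :=
  LinearMap.mk₂ ℂ (fun m a => convLeft (lact A M) (antipode ℂ) (ract A M m) a)
    (fun m n a => by simp [convLeft_apply, Finset.sum_add_distrib])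
    (fun c m a => by simp [convLeft_apply, Finset.smul_sum, smul_comm c])
    (fun m a b => map_add _ a b) (fun c m a => map_smul _ c a)

theorem adjAct_eq (m : M) : adjAct (A := A) m = convLeft (lact A M) (antipode ℂ) (ract A M m) := rfl

theorem adjAct_apply (m : M) (a : A) : adjAct m a =
    TensorProduct.lift ((lact A M).compl₁₂ (antipode ℂ) (ract A M m)) (comul (R := ℂ) a) := rfl

theorem adjAct_one (m : M) : adjAct m (1 : A) = m := by
  simp [adjAct_apply, Algebra.TensorProduct.one_def]

/-- S reverses products and the two actions commute: S(a₁ b₁) m a₂ b₂ = S(b₁) (S(a₁) m a₂) b₂. -/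
theorem adjAct_mul (m : M) (a b : A) : adjAct m (a * b) = adjAct (adjAct m a) b := by
  simp only [adjAct_apply, Bialgebra.comul_mul]
  generalize comul (R := ℂ) a = D
  generalize comul (R := ℂ) b = D'
  induction D' with
  | zero => simp
  | add D₁ D₂ h h' => simp only [mul_add, map_add, h, h']
  | tmul b' c' =>
    induction D with
    | zero => simp
    | add D₁ D₂ h h' =>
      simp only [add_mul, map_add, h, h']
      simp
    | tmul b c =>
      simp [antipode_mul_antidistrib, mul_smul, smul_comm (antipode ℂ b) (MulOpposite.op c')]

/-- `a₁ (m ◁ a₂) = m a`. -/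
theorem convLeft_id_adjAct (m : M) :
    convLeft (lact A M) LinearMap.id (adjAct (A := A) m) = ract A M m := by
  rw [adjAct_eq, convLeft_convLeft _ lact_mul, LinearMap.id_mul_antipode,
    convLeft_one _ (one_smul A)]

/-- `(m ◁ a₁) S(a₂) = S(a) m`. -/
theorem convRight_adjAct_antipode (m : M) :
    convRight (ract A M) (adjAct (A := A) m) (antipode ℂ) =
      (lact A M).flip m ∘ₗ antipode ℂ := by
  have h : adjAct (A := A) m =
      convRight (ract A M) ((lact A M).flip m ∘ₗ antipode ℂ) LinearMap.id := by
    ext a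
    simp [adjAct_eq, convLeft_apply, convRight_apply, smul_comm]
  rw [h, convRight_convRight _ ract_mul, LinearMap.id_mul_antipode,
    convRight_one _ (fun m => by simp)]

/-- The linear map `m ↦ S(m₍₋₁₎) m₍₀₎`, where `δ(m) = m₍₋₁₎ ⊗ m₍₀₎`. -/
def invProj (δ : M →ₗ[ℂ] A ⊗[ℂ] M) : M →ₗ[ℂ] M :=
  TensorProduct.lift (lact A M ∘ₗ antipode ℂ) ∘ₗ δ

/-- S(a₁ m₍₋₁₎) a₂ m₍₀₎ = S(m₍₋₁₎) S(a₁) a₂ m₍₀₎, and S(a₁) a₂ = ε(a). -/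
theorem invProj_smul (δ : M →ₗ[ℂ] A ⊗[ℂ] M)
    (hδ : ∀ a m, δ (a • m) = mulAM A M (comul (R := ℂ) a) (δ m)) (a : A) (m : M) :
    invProj δ (a • m) = counit (R := ℂ) a • invProj δ m := by
  simp only [invProj, LinearMap.comp_apply, hδ]
  generalize δ m = x
  induction x with
  | zero => simp
  | add x y h h' => simp only [map_add, smul_add, h, h']
  | tmul b e =>
    have h : ∀ D : A ⊗[ℂ] A, TensorProduct.lift (lact A M ∘ₗ antipode ℂ) (mulAM A M D (b ⊗ₜ e)) =
        antipode ℂ b • LinearMap.mul' ℂ A ((antipode ℂ).rTensor A D) • e := fun D => by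
      induction D with
      | zero => simp
      | add D D' h h' => simp only [map_add, LinearMap.add_apply, add_smul, smul_add, h, h']
      | tmul x y => simp [mulAM, antipode_mul_antidistrib, mul_smul]
    rw [h, mul_antipode_rTensor_comul_apply, algebraMap_smul]
    exact (lact A M (antipode ℂ b)).map_smul (counit (R := ℂ) a) e

theorem invProj_op_smul (δ : M →ₗ[ℂ] A ⊗[ℂ] M)
    (hδ : ∀ a m, δ (MulOpposite.op a • m) = rmulAM A M (δ m) (comul (R := ℂ) a)) (a : A) (m : M) :
    invProj δ (MulOpposite.op a • m) = adjAct (invProj δ m) a := by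
  simp only [invProj, LinearMap.comp_apply, hδ, adjAct_apply]
  generalize δ m = x
  generalize comul (R := ℂ) a = D
  induction D with
  | zero => simp
  | add D D' h h' => simp only [map_add, h, h']
  | tmul b c =>
    induction x with
    | zero => simp
    | add x y h h' => simp only [map_add, LinearMap.add_apply, h, h']; simp
    | tmul b' e =>
      simp [rmulAM, antipode_mul_antidistrib, mul_smul, smul_comm (antipode ℂ b') (MulOpposite.op c)]

theorem invProj_of_invariant (δ : M →ₗ[ℂ] A ⊗[ℂ] M) {m : M} (hm : δ m = 1 ⊗ₜ m) :
    invProj δ m = m := by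
  simp [invProj, hm]

/-- On a generator a x with x in X the value is ε(a) x, so no coassociativity of δ is needed.
Allowing X to be smaller than the space of invariants is what later determines all left-invariant
two-tensors. -/
theorem invProj_mem (δ : M →ₗ[ℂ] A ⊗[ℂ] M)
    (hδ : ∀ a m, δ (a • m) = mulAM A M (comul (R := ℂ) a) (δ m)) {X : Submodule ℂ M}
    (hX : X ≤ LinearMap.eqLocus δ (TensorProduct.mk ℂ A M 1))
    (hspan : Submodule.map₂ (lact A M) ⊤ X = ⊤) (m : M) : invProj δ m ∈ X := by
  have hle : Submodule.map₂ (lact A M) ⊤ X ≤ X.comap (invProj δ) := by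
    rw [Submodule.map₂_le]
    intro a _ x hx
    rw [Submodule.mem_comap, lact_apply, invProj_smul δ hδ, invProj_of_invariant δ (hX hx)]
    exact X.smul_mem _ hx
  exact hle (hspan ▸ Submodule.mem_top)

end Bimodule

namespace BicovariantCalculus

variable {A : Type*} [Ring A] [HopfAlgebra ℂ A]
variable {E : Type*} [AddCommGroup E] [Module ℂ E] [Module A E] [Module Aᵐᵒᵖ E]
  [IsScalarTower ℂ A E] [IsScalarTower ℂ Aᵐᵒᵖ E] [SMulCommClass A Aᵐᵒᵖ E]
variable (C : BicovariantCalculus A E)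

theorem mem_leftInv {e : E} : e ∈ C.leftInv ↔ C.coactL e = 1 ⊗ₜ e := Iff.rfl

theorem mem_rightInv {e : E} : e ∈ C.rightInv ↔ C.coactR e = e ⊗ₜ 1 := Iff.rfl

/-! ### Invariant one-forms -/

theorem coactL_comp_d : C.coactL ∘ₗ C.d = C.d.lTensor A ∘ₗ comul := by
  ext b
  have h := C.coactL_smul_d 1 b
  rwa [one_smul, Bialgebra.comul_one, mulAM_one] at h

theorem coactR_comp_d : C.coactR ∘ₗ C.d = C.d.rTensor A ∘ₗ comul := by
  ext b
  have h := C.coactR_smul_d 1 b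
  rwa [one_smul, Bialgebra.comul_one, mulMA_one] at h

/-- The left-invariant form `S(b₁) d b₂`. -/
def leftForm : A →ₗ[ℂ] E := convLeft (lact A E) (antipode ℂ) C.d

/-- The right-invariant form `d b₁ S(b₂)`. -/
def rightForm : A →ₗ[ℂ] E := convRight (ract A E) C.d (antipode ℂ)

/-- The coaction sends S(b₁) d b₂ to Δ(S(b₁)) (b₂ ⊗ 1) (1 ⊗ d b₃), and Δ(S(b₁)) (b₂ ⊗ 1) = 1 ⊗ S(b).
-/
theorem leftForm_mem (b : A) : C.leftForm b ∈ C.leftInv := by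
  have h₁ : C.coactL ∘ₗ C.d =
      convLeft (mulAM A E) inlTensor (TensorProduct.mk ℂ A E 1 ∘ₗ C.d) := by
    ext a
    rw [coactL_comp_d, convLeft_apply, LinearMap.comp_apply, ← (ℛ ℂ a).eq]
    simp [mulAM]
  have h₂ : C.coactL ∘ₗ C.leftForm =
      convLeft (mulAM A E) (comul ∘ₗ antipode ℂ) (C.coactL ∘ₗ C.d) :=
    comp_convLeft (act := lact A E) comul C.coactL C.coactL_left (antipode ℂ) C.d
  have h₃ : TensorProduct.mk ℂ A E 1 ∘ₗ C.leftForm =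
      convLeft (mulAM A E) (inrTensor ∘ₗ antipode ℂ) (TensorProduct.mk ℂ A E 1 ∘ₗ C.d) :=
    comp_convLeft (act := lact A E) inrTensor (TensorProduct.mk ℂ A E 1)
      (fun b n => by simp [mulAM]) (antipode ℂ) C.d
  have h₄ := convLeft_convLeft_of_eq (mulAM A E) mulAM_mul conv_comul_antipode_inlTensor
    (TensorProduct.mk ℂ A E 1 ∘ₗ C.d)
  rw [← h₁] at h₄
  exact LinearMap.congr_fun (h₂.trans (h₄.trans h₃.symm)) b

theorem rightForm_mem (b : A) : C.rightForm b ∈ C.rightInv := by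
  have h₁ : C.coactR ∘ₗ C.d =
      convRight (rmulMA A E) ((TensorProduct.mk ℂ E A).flip 1 ∘ₗ C.d) inrTensor := by
    ext a
    rw [coactR_comp_d, convRight_apply, LinearMap.comp_apply, ← (ℛ ℂ a).eq]
    simp [rmulMA]
  have h₂ : C.coactR ∘ₗ C.rightForm =
      convRight (rmulMA A E) (C.coactR ∘ₗ C.d) (comul ∘ₗ antipode ℂ) :=
    comp_convRight (act := ract A E) comul C.coactR (fun n b => C.coactR_right b n) C.d
      (antipode ℂ)
  have h₃ : (TensorProduct.mk ℂ E A).flip 1 ∘ₗ C.rightForm =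
      convRight (rmulMA A E) ((TensorProduct.mk ℂ E A).flip 1 ∘ₗ C.d)
        (inlTensor ∘ₗ antipode ℂ) :=
    comp_convRight (act := ract A E) inlTensor ((TensorProduct.mk ℂ E A).flip 1)
      (fun n b => by simp [rmulMA]) C.d (antipode ℂ)
  have h₄ := convRight_convRight_of_eq (rmulMA A E) rmulMA_mul conv_inrTensor_comul_antipode
    ((TensorProduct.mk ℂ E A).flip 1 ∘ₗ C.d)
  rw [← h₁] at h₄
  exact LinearMap.congr_fun (h₂.trans (h₄.trans h₃.symm)) b

theorem convLeft_id_leftForm : convLeft (lact A E) LinearMap.id C.leftForm = C.d := by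
  rw [leftForm, convLeft_convLeft _ lact_mul, LinearMap.id_mul_antipode,
    convLeft_one _ (one_smul A)]

theorem convRight_rightForm_id : convRight (ract A E) C.rightForm LinearMap.id = C.d := by
  rw [rightForm, convRight_convRight _ ract_mul, LinearMap.antipode_mul_id,
    convRight_one _ (fun m => by simp)]

/-- The span is a left submodule, and it contains d b = b₁ (S(b₂) d b₃). -/
theorem span_leftInv : Submodule.map₂ (lact A E) ⊤ C.leftInv = ⊤ := by
  have hsmul : ∀ (a : A), ∀ x ∈ Submodule.map₂ (lact A E) ⊤ C.leftInv,
      a • x ∈ Submodule.map₂ (lact A E) ⊤ C.leftInv := by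
    intro a
    suffices h : Submodule.map₂ (lact A E) ⊤ C.leftInv ≤
        (Submodule.map₂ (lact A E) ⊤ C.leftInv).comap (lact A E a) from fun x hx => h hx
    rw [Submodule.map₂_le]
    intro b _ ω hω
    rw [Submodule.mem_comap, ← lact_mul]
    exact Submodule.apply_mem_map₂ _ Submodule.mem_top hω
  rw [eq_top_iff]
  rintro e -
  induction e using C.induction_smul_d with
  | zero => exact zero_mem _
  | add x y hx hy => exact add_mem hx hy
  | smul_d a b =>
    refine hsmul a _ ?_
    rw [← C.convLeft_id_leftForm, convLeft_apply]
    exact sum_mem fun i _ => Submodule.apply_mem_map₂ _ Submodule.mem_top (C.leftForm_mem _)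

theorem span_rightInv : Submodule.map₂ (ract A E) C.rightInv ⊤ = ⊤ := by
  have hsmul : ∀ (a : A), ∀ x ∈ Submodule.map₂ (ract A E) C.rightInv ⊤,
      MulOpposite.op a • x ∈ Submodule.map₂ (ract A E) C.rightInv ⊤ := by
    intro a
    suffices h : Submodule.map₂ (ract A E) C.rightInv ⊤ ≤
        (Submodule.map₂ (ract A E) C.rightInv ⊤).comap ((ract A E).flip a) from fun x hx => h hx
    rw [Submodule.map₂_le]
    intro ω hω b _
    rw [Submodule.mem_comap, LinearMap.flip_apply, ← ract_mul]
    exact Submodule.apply_mem_map₂ _ hω Submodule.mem_top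
  have hd : ∀ b, C.d b ∈ Submodule.map₂ (ract A E) C.rightInv ⊤ := by
    intro b
    rw [← C.convRight_rightForm_id, convRight_apply]
    exact sum_mem fun i _ => Submodule.apply_mem_map₂ _ (C.rightForm_mem _) Submodule.mem_top
  rw [eq_top_iff]
  rintro e -
  induction e using C.induction_smul_d with
  | zero => exact zero_mem _
  | add x y hx hy => exact add_mem hx hy
  | smul_d a b =>
    -- Stability of this span under left multiplication is not available, so the Leibniz rule
    -- rewrites a d b as d(ab) - (d a) b, which involves only right multiplication.
    rw [← sub_eq_of_eq_add' (C.leibniz a b)]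
    exact sub_mem (hd _) (hsmul b _ (hd a))

/-! ### The coactions commute -/

/-- With `lTensor_coactR_mulAM`, this pulls the iterated coproduct of a out of both iterated
coactions of a d b, which reduces their equality to exact forms. -/
theorem assoc_rTensor_coactL_mulMA (D : A ⊗[ℂ] A) (y : E ⊗[ℂ] A) :
    TensorProduct.assoc ℂ A E A (C.coactL.rTensor A (mulMA A E D y)) =
      TensorProduct.map₂ (LinearMap.mul ℂ A) (mulMA A E)
        (TensorProduct.assoc ℂ A A A (comul.rTensor A D))
        (TensorProduct.assoc ℂ A E A (C.coactL.rTensor A y)) := by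
  induction D with
  | zero => simp
  | add D D' h h' => simp only [map_add, LinearMap.add_apply, h, h']
  | tmul b c =>
    induction y with
    | zero => simp
    | add y y' h h' => simp only [map_add, h, h']
    | tmul f g =>
      have h : ∀ (X : A ⊗[ℂ] A) (x : A ⊗[ℂ] E),
          TensorProduct.assoc ℂ A E A (mulAM A E X x ⊗ₜ (c * g)) =
            TensorProduct.map₂ (LinearMap.mul ℂ A) (mulMA A E)
              (TensorProduct.assoc ℂ A A A (X ⊗ₜ c)) (TensorProduct.assoc ℂ A E A (x ⊗ₜ g)) := by
        intro X x
        induction X with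
        | zero => simp
        | add D D' h h' => simp only [map_add, LinearMap.add_apply, TensorProduct.add_tmul, h, h']
        | tmul p q =>
          induction x with
          | zero => simp
          | add y y' h h' => simp only [map_add, TensorProduct.add_tmul, h, h']
          | tmul r s => simp [mulAM, mulMA]
      simpa [mulMA, C.coactL_left] using h (comul b) (C.coactL f)

theorem lTensor_coactR_mulAM (D : A ⊗[ℂ] A) (x : A ⊗[ℂ] E) :
    C.coactR.lTensor A (mulAM A E D x) =
      TensorProduct.map₂ (LinearMap.mul ℂ A) (mulMA A E)
        (comul.lTensor A D) (C.coactR.lTensor A x) := by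
  induction D with
  | zero => simp
  | add D D' h h' => simp only [map_add, LinearMap.add_apply, h, h']
  | tmul b c =>
    induction x with
    | zero => simp
    | add y y' h h' => simp only [map_add, h, h']
    | tmul f g => simp [mulAM, C.coactR_left]

/-- On d b both sides are id ⊗ d ⊗ id applied to the iterated coproduct of b, so coassociativity
suffices. -/
theorem coactL_coactR (e : E) :
    TensorProduct.assoc ℂ A E A (C.coactL.rTensor A (C.coactR e)) =
      C.coactR.lTensor A (C.coactL e) := by
  induction e using C.induction_smul_d with
  | zero => simp
  | add x y hx hy => simp only [map_add, hx, hy]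
  | smul_d a b =>
    rw [coactR_smul_d, coactL_smul_d, assoc_rTensor_coactL_mulMA, lTensor_coactR_mulAM,
      coassoc_apply]
    congr 1
    rw [← LinearMap.comp_apply (C.coactL.rTensor A), ← LinearMap.comp_apply (C.coactR.lTensor A),
      ← LinearMap.rTensor_comp, ← LinearMap.lTensor_comp, coactL_comp_d, coactR_comp_d,
      LinearMap.lTensor_comp, LinearMap.comp_apply, ← coassoc_apply, LinearMap.rTensor_comp,
      LinearMap.comp_apply]
    generalize comul.rTensor A (comul (R := ℂ) b) = z
    induction z with
    | zero => simp
    | add x y hx hy => simp only [map_add, hx, hy]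
    | tmul x y =>
      induction x with
      | zero => simp
      | add x y hx hy => simp only [map_add, TensorProduct.add_tmul, hx, hy]
      | tmul p q => simp

/-- Tensoring over ℂ is exact, so it preserves the kernel of f - g. -/
theorem mem_range_lTensor_eqLocus {V N P : Type*} [AddCommGroup V] [Module ℂ V] [AddCommGroup N]
    [Module ℂ N] [AddCommGroup P] [Module ℂ P] (f g : N →ₗ[ℂ] P) {x : V ⊗[ℂ] N}
    (h : f.lTensor V x = g.lTensor V x) :
    x ∈ LinearMap.range ((LinearMap.eqLocus f g).subtype.lTensor V) := by
  rw [LinearMap.eqLocus_eq_ker_sub]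
  refine (Module.Flat.lTensor_exact V (LinearMap.exact_subtype_ker_map (f - g)) x).1 ?_
  rw [LinearMap.lTensor_sub, LinearMap.sub_apply, h, sub_self]

theorem mem_range_rTensor_eqLocus {V N P : Type*} [AddCommGroup V] [Module ℂ V] [AddCommGroup N]
    [Module ℂ N] [AddCommGroup P] [Module ℂ P] (f g : N →ₗ[ℂ] P) {x : N ⊗[ℂ] V}
    (h : f.rTensor V x = g.rTensor V x) :
    x ∈ LinearMap.range ((LinearMap.eqLocus f g).subtype.rTensor V) := by
  rw [LinearMap.eqLocus_eq_ker_sub]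
  refine (Module.Flat.rTensor_exact V (LinearMap.exact_subtype_ker_map (f - g)) x).1 ?_
  rw [LinearMap.rTensor_sub, LinearMap.sub_apply, h, sub_self]

/-- Commutation of the coactions makes the second leg of `coactL η` equalise `coactR` and e ↦ e ⊗ 1,
the two maps that define `rightInv`. -/
theorem coactL_mem_of_rightInv {η : E} (hη : η ∈ C.rightInv) :
    C.coactL η ∈ LinearMap.range (C.rightInv.subtype.lTensor A) := by
  refine mem_range_lTensor_eqLocus _ _ ?_
  rw [← coactL_coactR, C.mem_rightInv.1 hη, LinearMap.rTensor_tmul]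
  generalize C.coactL η = x
  induction x with
  | zero => simp
  | add x y hx hy => simp only [map_add, TensorProduct.add_tmul, hx, hy]
  | tmul p q => simp

theorem coactR_mem_of_leftInv {ω : E} (hω : ω ∈ C.leftInv) :
    C.coactR ω ∈ LinearMap.range (C.leftInv.subtype.rTensor A) := by
  refine mem_range_rTensor_eqLocus _ _ ?_
  apply (TensorProduct.assoc ℂ A E A).injective
  rw [coactL_coactR, C.mem_leftInv.1 hω, LinearMap.lTensor_tmul]
  generalize C.coactR ω = x
  induction x with
  | zero => simp
  | add x y hx hy => simp only [map_add, TensorProduct.tmul_add, hx, hy]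
  | tmul p q => simp

end BicovariantCalculus

namespace BicovariantCalculus

variable {A : Type*} [Ring A] [HopfAlgebra ℂ A]
variable {E : Type*} [AddCommGroup E] [Module ℂ E] [Module A E] [Module Aᵐᵒᵖ E]
  [IsScalarTower ℂ A E] [IsScalarTower ℂ Aᵐᵒᵖ E] [SMulCommClass A Aᵐᵒᵖ E]
variable (C : BicovariantCalculus A E)

/-! ### Two-tensors -/

theorem mem_leftInv₂ {x : C.TwoTensor} : x ∈ C.leftInv₂ ↔ C.coactL₂ x = 1 ⊗ₜ x := Iff.rfl

theorem coactL₂_tmul (e f : E) : C.coactL₂ (TensorOver.tmul A E E e f) =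
    legsLeft A E E (C.coactL e) (C.coactL f) :=
  TensorOver.lift_tmul _ _ e f

theorem coactR₂_tmul (e f : E) : C.coactR₂ (TensorOver.tmul A E E e f) =
    legsRight A E E (C.coactR e) (C.coactR f) :=
  TensorOver.lift_tmul _ _ e f

theorem legsLeft_mulAM (D : A ⊗[ℂ] A) (x y : A ⊗[ℂ] E) :
    legsLeft A E E (mulAM A E D x) y = mulAM A (TensorOver A E E) D (legsLeft A E E x y) := by
  induction D with
  | zero => simp
  | add D D' h h' => simp only [map_add, LinearMap.add_apply, h, h']
  | tmul b c =>
    induction x with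
    | zero => simp
    | add x x' h h' => simp only [map_add, LinearMap.add_apply, h, h']
    | tmul p q =>
      induction y with
      | zero => simp
      | add y y' h h' => simp only [map_add, h, h']
      | tmul r s => simp [legsLeft, mulAM, mul_assoc, TensorOver.smul_tmul]

theorem legsLeft_rmulAM (D : A ⊗[ℂ] A) (x y : A ⊗[ℂ] E) :
    legsLeft A E E x (rmulAM A E y D) = rmulAM A (TensorOver A E E) (legsLeft A E E x y) D := by
  induction D with
  | zero => simp
  | add D D' h h' => simp only [map_add, h, h']
  | tmul b c =>
    induction x with
    | zero => simp
    | add x x' h h' => simp only [map_add, LinearMap.add_apply, h, h']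
    | tmul p q =>
      induction y with
      | zero => simp
      | add y y' h h' => simp only [map_add, LinearMap.add_apply, h, h']
      | tmul r s => simp [legsLeft, rmulAM, mul_assoc, TensorOver.op_smul_tmul]

theorem legsRight_mulMA (D : A ⊗[ℂ] A) (x y : E ⊗[ℂ] A) :
    legsRight A E E (mulMA A E D x) y = mulMA A (TensorOver A E E) D (legsRight A E E x y) := by
  induction D with
  | zero => simp
  | add D D' h h' => simp only [map_add, LinearMap.add_apply, h, h']
  | tmul b c =>
    induction x with
    | zero => simp
    | add x x' h h' => simp only [map_add, LinearMap.add_apply, h, h']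
    | tmul p q =>
      induction y with
      | zero => simp
      | add y y' h h' => simp only [map_add, h, h']
      | tmul r s => simp [legsRight, mulMA, mul_assoc, TensorOver.smul_tmul]

theorem legsRight_rmulMA (D : A ⊗[ℂ] A) (x y : E ⊗[ℂ] A) :
    legsRight A E E x (rmulMA A E y D) = rmulMA A (TensorOver A E E) (legsRight A E E x y) D := by
  induction D with
  | zero => simp
  | add D D' h h' => simp only [map_add, h, h']
  | tmul b c =>
    induction x with
    | zero => simp
    | add x x' h h' => simp only [map_add, LinearMap.add_apply, h, h']
    | tmul p q =>
      induction y with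
      | zero => simp
      | add y y' h h' => simp only [map_add, LinearMap.add_apply, h, h']
      | tmul r s => simp [legsRight, rmulMA, mul_assoc, TensorOver.op_smul_tmul]

theorem coactL₂_left (a : A) (x : C.TwoTensor) :
    C.coactL₂ (a • x) = mulAM A C.TwoTensor (comul (R := ℂ) a) (C.coactL₂ x) := by
  induction x using TensorOver.induction_on with
  | zero => simp
  | add x y hx hy => simp only [smul_add, map_add, hx, hy]
  | tmul e f => rw [TensorOver.smul_tmul, coactL₂_tmul, coactL₂_tmul, coactL_left, legsLeft_mulAM]

theorem coactL₂_right (a : A) (x : C.TwoTensor) : C.coactL₂ (MulOpposite.op a • x) =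
    rmulAM A C.TwoTensor (C.coactL₂ x) (comul (R := ℂ) a) := by
  induction x using TensorOver.induction_on with
  | zero => simp
  | add x y hx hy => simp only [smul_add, map_add, LinearMap.add_apply, hx, hy]
  | tmul e f =>
    rw [TensorOver.op_smul_tmul, coactL₂_tmul, coactL₂_tmul, coactL_right, legsLeft_rmulAM]

theorem coactR₂_left (a : A) (x : C.TwoTensor) :
    C.coactR₂ (a • x) = mulMA A C.TwoTensor (comul (R := ℂ) a) (C.coactR₂ x) := by
  induction x using TensorOver.induction_on with
  | zero => simp
  | add x y hx hy => simp only [smul_add, map_add, hx, hy]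
  | tmul e f =>
    rw [TensorOver.smul_tmul, coactR₂_tmul, coactR₂_tmul, coactR_left, legsRight_mulMA]

theorem coactR₂_right (a : A) (x : C.TwoTensor) : C.coactR₂ (MulOpposite.op a • x) =
    rmulMA A C.TwoTensor (C.coactR₂ x) (comul (R := ℂ) a) := by
  induction x using TensorOver.induction_on with
  | zero => simp
  | add x y hx hy => simp only [smul_add, map_add, LinearMap.add_apply, hx, hy]
  | tmul e f =>
    rw [TensorOver.op_smul_tmul, coactR₂_tmul, coactR₂_tmul, coactR_right, legsRight_rmulMA]

theorem map₂_induction {U V W : Type*} [AddCommGroup U] [Module ℂ U] [AddCommGroup V] [Module ℂ V]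
    [AddCommGroup W] [Module ℂ W] {f : U →ₗ[ℂ] V →ₗ[ℂ] W} {X : Submodule ℂ U} {Y : Submodule ℂ V}
    {p : W → Prop} (mem : ∀ u ∈ X, ∀ v ∈ Y, p (f u v)) (add : ∀ x y, p x → p y → p (x + y))
    {w : W} (hw : w ∈ Submodule.map₂ f X Y) : p w := by
  refine Submodule.iSup_induction (motive := p) _ hw ?_ ?_ add
  · rintro ⟨u, hu⟩ _ ⟨v, hv, rfl⟩
    exact mem u hu v hv
  · simpa using mem 0 (zero_mem _) 0 (zero_mem _)

theorem induction_leftInv {p : E → Prop} (e : E)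
    (smul : ∀ (a : A), ∀ ω ∈ C.leftInv, p (a • ω)) (add : ∀ x y, p x → p y → p (x + y)) :
    p e :=
  map₂_induction (fun a _ ω hω => smul a ω hω) add
    (C.span_leftInv ▸ Submodule.mem_top : e ∈ Submodule.map₂ (lact A E) ⊤ C.leftInv)

theorem induction_rightInv {p : E → Prop} (e : E)
    (op_smul : ∀ (a : A), ∀ η ∈ C.rightInv, p (MulOpposite.op a • η))
    (add : ∀ x y, p x → p y → p (x + y)) : p e :=
  map₂_induction (fun η hη a _ => op_smul a η hη) add
    (C.span_rightInv ▸ Submodule.mem_top : e ∈ Submodule.map₂ (ract A E) C.rightInv ⊤)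

/-- `E ⊗_A E` is spanned by the elements `a (ω ⊗ η) b` with `ω` left-invariant and `η`
right-invariant. -/
theorem induction_leftInv_rightInv {p : C.TwoTensor → Prop} (x : C.TwoTensor)
    (smul : ∀ (a b : A), ∀ ω ∈ C.leftInv, ∀ η ∈ C.rightInv,
      p (a • MulOpposite.op b • TensorOver.tmul A E E ω η))
    (add : ∀ x y, p x → p y → p (x + y)) : p x := by
  induction x using TensorOver.induction_on with
  | zero => simpa using smul 0 0 0 (zero_mem _) 0 (zero_mem _)
  | add x y hx hy => exact add _ _ hx hy
  | tmul e f =>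
    induction e using C.induction_leftInv with
    | add x y hx hy => rw [map_add, LinearMap.add_apply]; exact add _ _ hx hy
    | smul a ω hω =>
      induction f using C.induction_rightInv with
      | add x y hx hy => rw [map_add]; exact add _ _ hx hy
      | op_smul b η hη =>
        have := smul a b ω hω η hη
        rwa [TensorOver.op_smul_tmul, TensorOver.smul_tmul] at this

/-- The span of the elements `ω ⊗ ω'` with `ω` and `ω'` left-invariant. -/
def leftInvTensor : Submodule ℂ C.TwoTensor :=
  Submodule.map₂ (TensorOver.tmul A E E) C.leftInv C.leftInv

theorem leftInvTensor_le : C.leftInvTensor ≤ C.leftInv₂ := by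
  rw [leftInvTensor, Submodule.map₂_le]
  intro ω hω ω' hω'
  rw [mem_leftInv₂, coactL₂_tmul, C.mem_leftInv.1 hω, C.mem_leftInv.1 hω']
  simp [legsLeft]

theorem span_leftInvTensor : Submodule.map₂ (lact A C.TwoTensor) ⊤ C.leftInvTensor = ⊤ := by
  rw [eq_top_iff]
  rintro x -
  induction x using TensorOver.induction_on with
  | zero => exact zero_mem _
  | add x y hx hy => exact add_mem hx hy
  | tmul e f =>
    induction f using C.induction_leftInv generalizing e with
    | add x y hx hy => rw [map_add]; exact add_mem (hx e) (hy e)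
    | smul a ω hω =>
      -- The coefficient of the second factor moves to the first, e ⊗ a ω = e a ⊗ ω, and e a is then
      -- expanded over the left-invariant forms.
      rw [← TensorOver.tmul_balanced]
      generalize MulOpposite.op a • e = e'
      induction e' using C.induction_leftInv with
      | add x y hx hy => rw [map_add, LinearMap.add_apply]; exact add_mem hx hy
      | smul b ω' hω' =>
        rw [← TensorOver.smul_tmul]
        exact Submodule.apply_mem_map₂ (lact A C.TwoTensor) Submodule.mem_top
          (Submodule.apply_mem_map₂ _ hω' hω)

/-- An invariant element is fixed by `invProj`, whose values all lie in the generating space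
`leftInvTensor`. -/
theorem leftInv₂_eq : C.leftInv₂ = C.leftInvTensor := by
  refine le_antisymm (fun x hx => ?_) C.leftInvTensor_le
  rw [← invProj_of_invariant C.coactL₂ (C.mem_leftInv₂.1 hx)]
  exact invProj_mem _ C.coactL₂_left C.leftInvTensor_le C.span_leftInvTensor x

theorem finiteDimensional_leftInv₂ [hfin : FiniteDimensional ℂ C.leftInv] :
    FiniteDimensional ℂ C.leftInv₂ := by
  rw [leftInv₂_eq]
  have h : C.leftInv.FG := (Submodule.fg_iff_finiteDimensional _).2 hfin
  exact (Submodule.fg_iff_finiteDimensional _).1 (h.map₂ _ h)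

/-- For invariant x, the element x ◁ a is `invProj` applied to x a. -/
theorem adjAct_mem_leftInv₂ {x : C.TwoTensor} (hx : x ∈ C.leftInv₂) (a : A) :
    adjAct x a ∈ C.leftInv₂ := by
  have h := invProj_op_smul C.coactL₂ C.coactL₂_right a x
  rw [invProj_of_invariant C.coactL₂ (C.mem_leftInv₂.1 hx)] at h
  rw [← h]
  exact C.leftInvTensor_le
    (invProj_mem _ C.coactL₂_left C.leftInvTensor_le C.span_leftInvTensor _)

/-! ### The braiding -/

/-- The bilinear map `(a ⊗ e, f ⊗ b) ↦ a f ⊗ (S(e₍₋₁₎) e₍₀₎ ◁ b)`. -/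
def braidingLegs : A ⊗[ℂ] E →ₗ[ℂ] E ⊗[ℂ] A →ₗ[ℂ] C.TwoTensor :=
  (TensorProduct.map₂ (lact A E) (adjAct ∘ₗ invProj C.coactL)).compr₂ (TensorOver.mk A E E)

theorem braidingLegs_tmul (a b : A) (e f : E) : C.braidingLegs (a ⊗ₜ e) (f ⊗ₜ b) =
    TensorOver.tmul A E E (a • f) (adjAct (invProj C.coactL e) b) := by
  simp [braidingLegs, TensorOver.mk_tmul]

/-- A factor c crosses from one leg to the other because `invProj` turns right multiplication by c
into ◁ c, and ◁ is an action. This is what makes `braiding` well defined over A. -/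
theorem braidingLegs_balanced (x : A ⊗[ℂ] E) (D : A ⊗[ℂ] A) (y : E ⊗[ℂ] A) :
    C.braidingLegs (rmulAM A E x D) y = C.braidingLegs x (mulMA A E D y) := by
  induction D with
  | zero => simp
  | add D D' h h' => simp only [map_add, LinearMap.add_apply, h, h']
  | tmul b c =>
    induction x with
    | zero => simp
    | add x x' h h' => simp only [map_add, LinearMap.add_apply, h, h']
    | tmul p q =>
      induction y with
      | zero => simp
      | add y y' h h' => simp only [map_add, h, h']
      | tmul r s =>
        simp only [rmulAM, mulMA, TensorProduct.map₂_apply_tmul, TensorProduct.map_tmul, LinearMap.mul_apply',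
          lact_apply, ract_apply, braidingLegs_tmul, mul_smul,
          invProj_op_smul C.coactL C.coactL_right, adjAct_mul]

/-- The canonical braiding `e ⊗ f ↦ e₍₋₂₎ f₍₀₎ ⊗ S(e₍₋₁₎ f₍₁₎) e₍₀₎ f₍₂₎`. -/
def braiding : Module.End ℂ C.TwoTensor :=
  TensorOver.lift (C.braidingLegs.compl₁₂ C.coactL C.coactR) (fun m a n => by
    simp only [LinearMap.compl₁₂_apply, coactL_right, coactR_left, braidingLegs_balanced])

theorem braiding_tmul (e f : E) : C.braiding (TensorOver.tmul A E E e f) =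
    C.braidingLegs (C.coactL e) (C.coactR f) :=
  TensorOver.lift_tmul _ _ e f

/-- `invProj` replaces a₂ by ε(a₂), and a₁ ε(a₂) = a is left on the first factor. -/
theorem braidingLegs_left (a : A) (x : A ⊗[ℂ] E) (y : E ⊗[ℂ] A) :
    C.braidingLegs (mulAM A E (comul (R := ℂ) a) x) y = a • C.braidingLegs x y := by
  induction x with
  | zero => simp
  | add x x' h h' => simp only [map_add, LinearMap.add_apply, smul_add, h, h']
  | tmul p q =>
    induction y with
    | zero => simp
    | add y y' h h' => simp only [map_add, smul_add, h, h']
    | tmul r s =>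
      conv_rhs => rw [← sum_smul_counit a]
      conv_lhs => rw [← (ℛ ℂ a).eq]
      simp only [map_sum, LinearMap.sum_apply, Finset.sum_smul, mulAM,
        TensorProduct.map₂_apply_tmul, TensorProduct.map_tmul, LinearMap.mul_apply', lact_apply, braidingLegs_tmul,
        invProj_smul C.coactL C.coactL_left, map_smul, LinearMap.smul_apply,
        TensorOver.smul_tmul, mul_smul, smul_assoc]

/-- In r a₁ ⊗ (m ◁ a₂) the factor a₁ moves across the tensor sign, and a₁ (m ◁ a₂) = m a. -/
theorem braidingLegs_right (a : A) (x : A ⊗[ℂ] E) (y : E ⊗[ℂ] A) :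
    C.braidingLegs x (rmulMA A E y (comul (R := ℂ) a)) =
      MulOpposite.op a • C.braidingLegs x y := by
  induction x with
  | zero => simp
  | add x x' h h' => simp only [map_add, LinearMap.add_apply, smul_add, h, h']
  | tmul p q =>
    induction y with
    | zero => simp
    | add y y' h h' => simp only [map_add, LinearMap.add_apply, smul_add, h, h']
    | tmul r s =>
      have h := LinearMap.congr_fun
        (convLeft_id_adjAct (A := A) (adjAct (invProj C.coactL q) s)) a
      rw [convLeft_apply] at h
      conv_lhs => rw [← (ℛ ℂ a).eq]
      rw [braidingLegs_tmul, TensorOver.op_smul_tmul, ← ract_apply, ← h]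
      simp only [map_sum, rmulMA, TensorProduct.map₂_apply_tmul, TensorProduct.map_tmul, LinearMap.mul_apply',
        ract_apply, lact_apply, braidingLegs_tmul, adjAct_mul, ← TensorOver.tmul_balanced,
        LinearMap.id_apply, smul_comm p]

theorem isBraiding_braiding : C.IsBraiding C.braiding where
  isBimoduleMap := by
    constructor
    · intro a x
      induction x using TensorOver.induction_on with
      | zero => simp
      | add x y hx hy => simp only [smul_add, map_add, hx, hy]
      | tmul e f =>
        rw [TensorOver.smul_tmul, braiding_tmul, braiding_tmul, coactL_left, braidingLegs_left]
    · intro a x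
      induction x using TensorOver.induction_on with
      | zero => simp
      | add x y hx hy => simp only [smul_add, map_add, hx, hy]
      | tmul e f =>
        rw [TensorOver.op_smul_tmul, braiding_tmul, braiding_tmul, coactR_right,
          braidingLegs_right]
  swap ω hω η hη := by
    rw [braiding_tmul, C.mem_leftInv.1 hω, C.mem_rightInv.1 hη, braidingLegs_tmul, one_smul,
      adjAct_one, invProj_of_invariant _ (C.mem_leftInv.1 hω)]

variable {C} {σ : Module.End ℂ C.TwoTensor}

theorem IsBraiding.eq {τ : Module.End ℂ C.TwoTensor} (hσ : C.IsBraiding σ)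
    (hτ : C.IsBraiding τ) : σ = τ := by
  ext x
  induction x using C.induction_leftInv_rightInv with
  | add x y hx hy => simp only [map_add, hx, hy]
  | smul a b ω hω η hη =>
    rw [hσ.isBimoduleMap.map_left, hσ.isBimoduleMap.map_right, hσ.swap ω hω η hη,
      hτ.isBimoduleMap.map_left, hτ.isBimoduleMap.map_right, hτ.swap ω hω η hη]

theorem lTensor_mulAM (h : IsBimoduleMap A σ) (D : A ⊗[ℂ] A) (x : A ⊗[ℂ] C.TwoTensor) :
    σ.lTensor A (mulAM A _ D x) = mulAM A _ D (σ.lTensor A x) := by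
  induction D with
  | zero => simp
  | add D D' h h' => simp only [map_add, LinearMap.add_apply, h, h']
  | tmul b c =>
    induction x with
    | zero => simp
    | add x x' h h' => simp only [map_add, h, h']
    | tmul p q => simp [mulAM, h.map_left]

theorem lTensor_rmulAM (h : IsBimoduleMap A σ) (D : A ⊗[ℂ] A) (x : A ⊗[ℂ] C.TwoTensor) :
    σ.lTensor A (rmulAM A _ x D) = rmulAM A _ (σ.lTensor A x) D := by
  induction D with
  | zero => simp
  | add D D' h h' => simp only [map_add, h, h']
  | tmul b c =>
    induction x with
    | zero => simp
    | add x x' h h' => simp only [map_add, LinearMap.add_apply, h, h']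
    | tmul p q => simp [rmulAM, h.map_right]

theorem rTensor_mulMA (h : IsBimoduleMap A σ) (D : A ⊗[ℂ] A) (x : C.TwoTensor ⊗[ℂ] A) :
    σ.rTensor A (mulMA A _ D x) = mulMA A _ D (σ.rTensor A x) := by
  induction D with
  | zero => simp
  | add D D' h h' => simp only [map_add, LinearMap.add_apply, h, h']
  | tmul b c =>
    induction x with
    | zero => simp
    | add x x' h h' => simp only [map_add, h, h']
    | tmul p q => simp [mulMA, h.map_left]

theorem rTensor_rmulMA (h : IsBimoduleMap A σ) (D : A ⊗[ℂ] A) (x : C.TwoTensor ⊗[ℂ] A) :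
    σ.rTensor A (rmulMA A _ x D) = rmulMA A _ (σ.rTensor A x) D := by
  induction D with
  | zero => simp
  | add D D' h h' => simp only [map_add, h, h']
  | tmul b c =>
    induction x with
    | zero => simp
    | add x x' h h' => simp only [map_add, LinearMap.add_apply, h, h']
    | tmul p q => simp [rmulMA, h.map_right]

theorem IsBraiding.isBicovariant (hσ : C.IsBraiding σ) : C.IsBicovariant σ where
  left := by
    ext x
    rw [LinearMap.comp_apply, LinearMap.comp_apply]
    induction x using C.induction_leftInv_rightInv with
    | add x y hx hy => simp only [map_add, hx, hy]
    | smul a b ω hω η hη =>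
      rw [hσ.isBimoduleMap.map_left, hσ.isBimoduleMap.map_right, hσ.swap ω hω η hη,
        coactL₂_left, coactL₂_right, coactL₂_left, coactL₂_right,
        lTensor_mulAM hσ.isBimoduleMap, lTensor_rmulAM hσ.isBimoduleMap, coactL₂_tmul,
        coactL₂_tmul, C.mem_leftInv.1 hω]
      congr 2
      -- The second leg of the coaction of η is again right-invariant, so σ swaps it with ω.
      obtain ⟨z, hz⟩ := C.coactL_mem_of_rightInv hη
      rw [← hz]
      clear hz
      induction z with
      | zero => simp
      | add x y hx hy => simp only [map_add, LinearMap.add_apply, hx, hy]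
      | tmul p q => simp [legsLeft, hσ.swap ω hω q q.2]
  right := by
    ext x
    rw [LinearMap.comp_apply, LinearMap.comp_apply]
    induction x using C.induction_leftInv_rightInv with
    | add x y hx hy => simp only [map_add, hx, hy]
    | smul a b ω hω η hη =>
      rw [hσ.isBimoduleMap.map_left, hσ.isBimoduleMap.map_right, hσ.swap ω hω η hη,
        coactR₂_left, coactR₂_right, coactR₂_left, coactR₂_right,
        rTensor_mulMA hσ.isBimoduleMap, rTensor_rmulMA hσ.isBimoduleMap, coactR₂_tmul,
        coactR₂_tmul, C.mem_rightInv.1 hη]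
      congr 2
      obtain ⟨z, hz⟩ := C.coactR_mem_of_leftInv hω
      rw [← hz]
      clear hz
      induction z with
      | zero => simp
      | add x y hx hy => simp only [map_add, LinearMap.add_apply, hx, hy]
      | tmul p q => simp [legsRight, hσ.swap p p.2 η hη]

theorem IsBicovariant.map_leftInv₂ (hσ : C.IsBicovariant σ) :
    ∀ x ∈ C.leftInv₂, σ x ∈ C.leftInv₂ := by
  intro x hx
  have h := LinearMap.congr_fun hσ.left x
  rw [LinearMap.comp_apply, LinearMap.comp_apply, C.mem_leftInv₂.1 hx,
    LinearMap.lTensor_tmul] at h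
  exact h

end BicovariantCalculus

/-! ### Polynomials in an endomorphism -/

section Polynomial

variable {V W : Type*} [AddCommGroup V] [Module ℂ V] [AddCommGroup W] [Module ℂ W]

/-- Applied with `k` a multiplication by an element of A or a coaction, this passes compatibility
from σ to every polynomial in σ. -/
theorem comp_aeval_of_comp_eq {k : V →ₗ[ℂ] W} {f : Module.End ℂ V} {g : Module.End ℂ W}
    (h : k ∘ₗ f = g ∘ₗ k) (p : Polynomial ℂ) :
    k ∘ₗ Polynomial.aeval f p = Polynomial.aeval g p ∘ₗ k := by
  induction p using Polynomial.induction_on with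
  | C c => ext x; simp
  | add p q hp hq => rw [map_add, map_add, LinearMap.comp_add, LinearMap.add_comp, hp, hq]
  | monomial n c hn =>
    rw [pow_succ, ← mul_assoc, map_mul _ _ Polynomial.X, map_mul _ _ Polynomial.X,
      Polynomial.aeval_X, Polynomial.aeval_X,
      Module.End.mul_eq_comp, Module.End.mul_eq_comp, ← LinearMap.comp_assoc, hn,
      LinearMap.comp_assoc, h, LinearMap.comp_assoc]

theorem aeval_apply_of_apply_eq_smul {f : Module.End ℂ V} {μ : ℂ} {x : V} (h : f x = μ • x)
    (p : Polynomial ℂ) : Polynomial.aeval f p x = p.eval μ • x := by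
  by_cases hx : x = 0
  · simp [hx]
  · exact Module.End.aeval_apply_of_hasEigenvector
      ⟨Module.End.mem_eigenspace_iff.2 h, hx⟩

/-- The polynomial `∏_{μ ∈ Λ \ {1}} (X - μ) / (1 - μ)`. -/
def symPoly (Λ : Finset ℂ) : Polynomial ℂ :=
  ∏ μ ∈ Λ.erase 1, Polynomial.C (1 - μ)⁻¹ * (Polynomial.X - Polynomial.C μ)

theorem eval_symPoly_one (Λ : Finset ℂ) : (symPoly Λ).eval 1 = 1 := by
  rw [symPoly, Polynomial.eval_prod]
  refine Finset.prod_eq_one fun μ hμ => ?_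
  have : (1 : ℂ) - μ ≠ 0 := sub_ne_zero.2 (Finset.ne_of_mem_erase hμ).symm
  simp [inv_mul_cancel₀ this]

theorem eval_symPoly_eq_zero {Λ : Finset ℂ} {μ : ℂ} (hμ : μ ∈ Λ) (h1 : μ ≠ 1) :
    (symPoly Λ).eval μ = 0 := by
  rw [symPoly, Polynomial.eval_prod]
  exact Finset.prod_eq_zero (Finset.mem_erase.2 ⟨h1, hμ⟩) (by simp)

theorem eigenSumNeOne_le {V : Submodule ℂ W} {f : Module.End ℂ V} {X : Submodule ℂ W}
    (h : ∀ μ ≠ (1 : ℂ), ∀ w ∈ f.eigenspace μ, (w : W) ∈ X) : eigenSumNeOne f ≤ X := by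
  rw [eigenSumNeOne, Submodule.map_le_iff_le_comap]
  exact iSup₂_le h

theorem mem_eigenSumNeOne {V : Submodule ℂ W} {f : Module.End ℂ V} {μ : ℂ} (hμ : μ ≠ 1) {w : V}
    (hw : f w = μ • w) : (w : W) ∈ eigenSumNeOne f :=
  Submodule.mem_map_of_mem
    (Submodule.mem_iSup_of_mem μ
      (Submodule.mem_iSup_of_mem hμ (Module.End.mem_eigenspace_iff.2 hw)))

end Polynomial

section BimoduleMap

variable {A : Type*} [Ring A] [HopfAlgebra ℂ A]
variable {M : Type*} [AddCommGroup M] [Module ℂ M] [Module A M] [Module Aᵐᵒᵖ M]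
  [IsScalarTower ℂ A M] [IsScalarTower ℂ Aᵐᵒᵖ M] [SMulCommClass A Aᵐᵒᵖ M]
variable {f : Module.End ℂ M}

theorem IsBimoduleMap.aeval (hf : IsBimoduleMap A f) (p : Polynomial ℂ) :
    IsBimoduleMap A (Polynomial.aeval f p) where
  map_left a m := by
    have h : lact A M a ∘ₗ f = f ∘ₗ lact A M a := by
      ext m; exact (hf.map_left a m).symm
    exact (LinearMap.congr_fun (comp_aeval_of_comp_eq h p) m).symm
  map_right a m := by
    have h : (ract A M).flip a ∘ₗ f = f ∘ₗ (ract A M).flip a := by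
      ext m; exact (hf.map_right a m).symm
    exact (LinearMap.congr_fun (comp_aeval_of_comp_eq h p) m).symm

theorem IsBimoduleMap.map_adjAct (hf : IsBimoduleMap A f) (m : M) (a : A) :
    f (adjAct m a) = adjAct (f m) a := by
  simp [adjAct_eq, convLeft_apply, hf.map_left, hf.map_right]

end BimoduleMap

/-! ### Splitting of the two-tensors by the eigenvalues of ₀σ -/

namespace BicovariantCalculus

variable {A : Type*} [Ring A] [HopfAlgebra ℂ A]
variable {E : Type*} [AddCommGroup E] [Module ℂ E] [Module A E] [Module Aᵐᵒᵖ E]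
  [IsScalarTower ℂ A E] [IsScalarTower ℂ Aᵐᵒᵖ E] [SMulCommClass A Aᵐᵒᵖ E]
variable {C : BicovariantCalculus A E} {σ : Module.End ℂ C.TwoTensor}

theorem IsBicovariant.aeval (hσ : C.IsBicovariant σ) (p : Polynomial ℂ) :
    C.IsBicovariant (Polynomial.aeval σ p) where
  left := by
    rw [comp_aeval_of_comp_eq hσ.left p]
    congr 1
    -- The map f ↦ id ⊗ f is an algebra homomorphism, hence commutes with evaluation of polynomials.
    exact Polynomial.aeval_algHom_apply (Module.End.lTensorAlgHom ℂ C.TwoTensor A) σ p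
  right := by
    rw [comp_aeval_of_comp_eq hσ.right p]
    congr 1
    exact Polynomial.aeval_algHom_apply (Module.End.rTensorAlgHom ℂ C.TwoTensor A) σ p

theorem IsBraiding.ker_wedge (hσ : C.IsBraiding σ) :
    LinearMap.ker hσ.wedge = LinearMap.ker (σ - 1) :=
  Submodule.ker_mkQ _

theorem span_leftInv₂ : Submodule.map₂ (lact A C.TwoTensor) ⊤ C.leftInv₂ = ⊤ := by
  rw [leftInv₂_eq, span_leftInvTensor]

variable (hinv : ∀ x ∈ C.leftInv₂, σ x ∈ C.leftInv₂)

theorem apply_of_restrict_apply {μ : ℂ} {w : C.leftInv₂} (hw : σ.restrict hinv w = μ • w) :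
    σ w = μ • (w : C.TwoTensor) :=
  congrArg Subtype.val hw

/-- A bimodule map commutes with ◁, and ◁ preserves the left-invariant two-tensors, so each
eigenspace of ₀σ is stable under ◁. -/
theorem adjAct_mem_eigenSumNeOne (hσ : IsBimoduleMap A σ) (a : A) {w : C.TwoTensor}
    (hw : w ∈ eigenSumNeOne (σ.restrict hinv)) :
    adjAct w a ∈ eigenSumNeOne (σ.restrict hinv) := by
  suffices h : eigenSumNeOne (σ.restrict hinv) ≤
      (eigenSumNeOne (σ.restrict hinv)).comap (adjAct.flip a) from h hw
  refine eigenSumNeOne_le fun μ hμ w hw => ?_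
  have hw' := apply_of_restrict_apply hinv (Module.End.mem_eigenspace_iff.1 hw)
  refine mem_eigenSumNeOne hμ (w := ⟨adjAct (w : C.TwoTensor) a, C.adjAct_mem_leftInv₂ w.2 a⟩)
    (Subtype.ext ?_)
  change σ (adjAct (w : C.TwoTensor) a) = μ • adjAct (w : C.TwoTensor) a
  rw [hσ.map_adjAct, hw', map_smul, LinearMap.smul_apply]

/-- If the antipode is surjective, then `A · ₀F ⊆ ₀F · A`. -/
theorem map₂_lact_le_map₂_ract (hσ : IsBimoduleMap A σ)
    (hS : Function.Surjective (antipode ℂ (A := A))) :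
    Submodule.map₂ (lact A C.TwoTensor) ⊤ (eigenSumNeOne (σ.restrict hinv)) ≤
      Submodule.map₂ (ract A C.TwoTensor) (eigenSumNeOne (σ.restrict hinv)) ⊤ := by
  rw [Submodule.map₂_le]
  intro a _ w hw
  -- With a = S(b), the product a w becomes (w ◁ b₁) S(b₂).
  obtain ⟨b, rfl⟩ := hS a
  have h := LinearMap.congr_fun (convRight_adjAct_antipode (A := A) w) b
  rw [convRight_apply] at h
  change _ = lact A C.TwoTensor (antipode ℂ b) w at h
  rw [← h]
  exact sum_mem fun i _ => Submodule.apply_mem_map₂ _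
    (adjAct_mem_eigenSumNeOne hinv hσ _ hw) Submodule.mem_top

/-- E ⊗_A E is generated over A by eigenvectors of ₀σ; those for the eigenvalue 1 generate elements
of Ker(σ - 1), as σ is left A-linear. -/
theorem ker_sub_one_sup_eq_top (hσ : IsBimoduleMap A σ)
    (hdiag : IsDiagonalisable (σ.restrict hinv)) :
    LinearMap.ker (σ - 1) ⊔
      Submodule.map₂ (lact A C.TwoTensor) ⊤ (eigenSumNeOne (σ.restrict hinv)) = ⊤ := by
  rw [eq_top_iff, ← span_leftInv₂, Submodule.map₂_le]
  intro a _ w hw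
  suffices h : (⊤ : Submodule ℂ C.leftInv₂) ≤ ((LinearMap.ker (σ - 1) ⊔
      Submodule.map₂ (lact A C.TwoTensor) ⊤ (eigenSumNeOne (σ.restrict hinv))).comap
        (lact A C.TwoTensor a)).comap C.leftInv₂.subtype from
    h (Submodule.mem_top : (⟨w, hw⟩ : C.leftInv₂) ∈ ⊤)
  rw [← hdiag, iSup_le_iff]
  intro μ w hw
  rw [Module.End.mem_eigenspace_iff] at hw
  by_cases hμ : μ = 1
  · refine Submodule.mem_sup_left (LinearMap.mem_ker.2 ?_)
    have hw' := apply_of_restrict_apply hinv hw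
    rw [hμ, one_smul] at hw'
    change σ (a • (w : C.TwoTensor)) - a • (w : C.TwoTensor) = 0
    rw [hσ.map_left, hw', sub_self]
  · exact Submodule.mem_sup_right
      (Submodule.apply_mem_map₂ _ Submodule.mem_top (mem_eigenSumNeOne hμ hw))

theorem aeval_symPoly_of_mem_ker (Λ : Finset ℂ) {x : C.TwoTensor}
    (hx : x ∈ LinearMap.ker (σ - 1)) : Polynomial.aeval σ (symPoly Λ) x = x := by
  have h : σ x = (1 : ℂ) • x := by rw [one_smul]; exact sub_eq_zero.1 hx
  rw [aeval_apply_of_apply_eq_smul h, eval_symPoly_one, one_smul]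

theorem map₂_le_ker_aeval_symPoly (hσ : IsBimoduleMap A σ) {Λ : Finset ℂ}
    (hΛ : ∀ μ : ℂ, μ ∈ Λ ↔ Module.End.HasEigenvalue (σ.restrict hinv) μ) :
    Submodule.map₂ (lact A C.TwoTensor) ⊤ (eigenSumNeOne (σ.restrict hinv)) ≤
      LinearMap.ker (Polynomial.aeval σ (symPoly Λ)) := by
  rw [Submodule.map₂_le]
  intro a _ w hw
  suffices h : w ∈ LinearMap.ker (Polynomial.aeval σ (symPoly Λ)) by
    rw [LinearMap.mem_ker] at h ⊢
    rw [lact_apply, (hσ.aeval _).map_left, h, smul_zero]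
  refine eigenSumNeOne_le (fun μ hμ w hw => ?_) hw
  rw [LinearMap.mem_ker, aeval_apply_of_apply_eq_smul
    (apply_of_restrict_apply hinv (Module.End.mem_eigenspace_iff.1 hw))]
  by_cases hw0 : w = 0
  · simp [hw0]
  · rw [eval_symPoly_eq_zero ((hΛ μ).2 (Module.End.hasEigenvalue_of_hasEigenvector ⟨hw, hw0⟩)) hμ,
      zero_smul]

/-- The kernel of a bimodule endomorphism. -/
def kerSubBimodule {f : Module.End ℂ C.TwoTensor} (hf : IsBimoduleMap A f) :
    SubBimodule A C.TwoTensor where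
  toSubmodule := LinearMap.ker f
  left_mem a m hm := by
    have h : f m = 0 := hm
    change f (a • m) = 0
    rw [hf.map_left, h, smul_zero]
  right_mem a m hm := by
    have h : f m = 0 := hm
    change f (MulOpposite.op a • m) = 0
    rw [hf.map_right, h, smul_zero]

theorem IsBraiding.isBimoduleIso_wedge (hσ : C.IsBraiding σ) {F : SubBimodule A C.TwoTensor}
    (h : IsCompl (LinearMap.ker hσ.wedge) F.toSubmodule) :
    IsBimoduleIso A (hσ.wedge ∘ₗ F.incl) where
  isBimoduleMap := ⟨fun _ _ => rfl, fun _ _ => rfl⟩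
  bijective := by
    constructor
    · rw [← LinearMap.ker_eq_bot, LinearMap.ker_eq_bot']
      intro x hx
      apply F.incl_injective
      rw [map_zero]
      exact Submodule.disjoint_def.1 h.disjoint _ hx x.2
    · intro y
      obtain ⟨x, rfl⟩ := hσ.kerSubOne.proj_surjective y
      obtain ⟨u, hu, v, hv, rfl⟩ := Submodule.mem_sup.1
        (h.sup_eq_top ▸ Submodule.mem_top : x ∈ LinearMap.ker hσ.wedge ⊔ F.toSubmodule)
      refine ⟨⟨v, hv⟩, ?_⟩
      change hσ.wedge v = hσ.wedge (u + v)
      rw [map_add, LinearMap.mem_ker.1 hu, zero_add]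

end BicovariantCalculus

end BicovCalc

end

/-! ### The projection `P` and the resulting decomposition -/

open BicovCalc in
theorem mainTheorem3 {A : Type*} [Ring A] [HopfAlgebra ℂ A]
    {E : Type*} [AddCommGroup E] [Module ℂ E] [Module A E] [Module Aᵐᵒᵖ E]
    [IsScalarTower ℂ A E] [IsScalarTower ℂ Aᵐᵒᵖ E] [SMulCommClass A Aᵐᵒᵖ E]
    (C : BicovariantCalculus A E) (hfin : FiniteDimensional ℂ C.leftInv) :
    -- the canonical braiding exists, is unique, and restricts to `₀(E ⊗_A E)`
    (∃! σ : Module.End ℂ C.TwoTensor, C.IsBraiding σ) ∧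
    ∀ (σ : Module.End ℂ C.TwoTensor) (hσ : C.IsBraiding σ),
      ∃ hinv : ∀ x ∈ C.leftInv₂, σ x ∈ C.leftInv₂,
        IsDiagonalisable (σ.restrict hinv) →
        ∃ F : SubBimodule A C.TwoTensor,
          -- `F` is generated over `A` by the eigenspaces of `₀σ` for the eigenvalues `≠ 1`
          F.toSubmodule =
            Submodule.map₂ (lact A C.TwoTensor) ⊤ (eigenSumNeOne (σ.restrict hinv)) ∧
          (Function.Bijective (HopfAlgebra.antipode ℂ (A := A)) →
            F.toSubmodule =
              Submodule.map₂ (ract A C.TwoTensor) (eigenSumNeOne (σ.restrict hinv)) ⊤) ∧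
          -- `E ⊗_A E = Ker(∧) ⊕ F`, and `∧` restricts to an isomorphism `F ≅ Ω²(A)`
          IsCompl (LinearMap.ker hσ.wedge) F.toSubmodule ∧
          IsBimoduleIso A (hσ.wedge ∘ₗ F.incl) ∧
          -- the idempotent `P_sym`
          ∃ P : Module.End ℂ C.TwoTensor,
            IsIdempotentElem P ∧ IsBimoduleMap A P ∧ C.IsBicovariant P ∧
            LinearMap.range P = LinearMap.ker hσ.wedge ∧
            LinearMap.ker P = F.toSubmodule ∧
            ∃ Λ : Finset ℂ,
              (∀ μ : ℂ, μ ∈ Λ ↔ Module.End.HasEigenvalue (σ.restrict hinv) μ) ∧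
              P = Polynomial.aeval σ (∏ μ ∈ Λ.erase 1,
                Polynomial.C (1 - μ)⁻¹ * (Polynomial.X - Polynomial.C μ)) := by
  refine ⟨⟨C.braiding, C.isBraiding_braiding, fun τ hτ => hτ.eq C.isBraiding_braiding⟩,
    fun σ hσ => ⟨hσ.isBicovariant.map_leftInv₂, fun hdiag => ?_⟩⟩
  have hbim := hσ.isBimoduleMap
  have hinv := hσ.isBicovariant.map_leftInv₂
  have := C.finiteDimensional_leftInv₂
  obtain ⟨Λ, hΛ⟩ : ∃ Λ : Finset ℂ,
      ∀ μ : ℂ, μ ∈ Λ ↔ Module.End.HasEigenvalue (σ.restrict hinv) μ :=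
    ⟨(Module.End.finite_hasEigenvalue (σ.restrict hinv)).toFinset, fun μ => by simp⟩
  obtain ⟨P, hP⟩ : ∃ P, P = Polynomial.aeval σ (symPoly Λ) := ⟨_, rfl⟩
  have hPbim : IsBimoduleMap A P := hP ▸ hbim.aeval _
  have hfix : ∀ x ∈ LinearMap.ker (σ - 1), P x = x := fun x hx =>
    hP ▸ BicovariantCalculus.aeval_symPoly_of_mem_ker Λ hx
  have hFle : Submodule.map₂ (lact A C.TwoTensor) ⊤ (eigenSumNeOne (σ.restrict hinv)) ≤
      LinearMap.ker P := hP ▸ BicovariantCalculus.map₂_le_ker_aeval_symPoly hinv hbim hΛ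
  -- P picks out the Ker(σ - 1) component of any such decomposition. Its kernel, its range and its
  -- idempotency are all read off from this.
  have hdec : ∀ x, ∃ y ∈ LinearMap.ker (σ - 1), ∃ z ∈ Submodule.map₂ (lact A C.TwoTensor) ⊤
      (eigenSumNeOne (σ.restrict hinv)), y + z = x ∧ P x = y := by
    intro x
    obtain ⟨y, hy, z, hz, rfl⟩ := Submodule.mem_sup.1
      (BicovariantCalculus.ker_sub_one_sup_eq_top hinv hbim hdiag ▸ Submodule.mem_top : x ∈ _)
    exact ⟨y, hy, z, hz, rfl, by rw [map_add, hfix y hy, LinearMap.mem_ker.1 (hFle hz), add_zero]⟩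
  have hker : LinearMap.ker P =
      Submodule.map₂ (lact A C.TwoTensor) ⊤ (eigenSumNeOne (σ.restrict hinv)) := by
    refine le_antisymm (fun x hx => ?_) hFle
    obtain ⟨y, -, z, hz, rfl, hPx⟩ := hdec x
    rw [← hPx, LinearMap.mem_ker.1 hx, zero_add]
    exact hz
  have hrange : LinearMap.range P = LinearMap.ker hσ.wedge := by
    rw [hσ.ker_wedge]
    refine le_antisymm ?_ fun x hx => ⟨x, hfix x hx⟩
    rintro _ ⟨x, rfl⟩
    obtain ⟨y, hy, z, -, -, hPx⟩ := hdec x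
    exact hPx ▸ hy
  have hidem : IsIdempotentElem P := by
    ext x
    obtain ⟨y, hy, z, -, -, hPx⟩ := hdec x
    rw [Module.End.mul_apply, hPx, hfix y hy]
  have hcompl : IsCompl (LinearMap.ker hσ.wedge)
      (BicovariantCalculus.kerSubBimodule hPbim).toSubmodule := by
    rw [← hrange]
    exact LinearMap.IsIdempotentElem.isCompl hidem
  -- F is taken to be Ker P, since right stability is then automatic, while it is not visible from A
  -- · ₀F.
  refine ⟨BicovariantCalculus.kerSubBimodule hPbim, hker, fun hS => ?_, hcompl,
    hσ.isBimoduleIso_wedge hcompl, P, hidem, hPbim, hP ▸ hσ.isBicovariant.aeval _, hrange, rfl,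
    Λ, hΛ, hP⟩
  refine hker.trans (le_antisymm
    (BicovariantCalculus.map₂_lact_le_map₂_ract hinv hbim hS.surjective) ?_)
  rw [← hker, Submodule.map₂_le]
  intro w hw a _
  refine (BicovariantCalculus.kerSubBimodule hPbim).right_mem a w (hFle ?_)
  -- w = 1 · w puts ₀F inside A · ₀F.
  simpa using Submodule.apply_mem_map₂ (lact A C.TwoTensor) (Submodule.mem_top (x := 1)) hw
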